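/- For each $N\in\mathbb N$ let $(X_\sigma)_{\sigma\in\mathcal S_N}$, $\mathcal S_N=\{-1,+1\}^N$, be independent standard normal random variables, all defined on one probability space $(\Omega,\mathcal F,P)$ with expectation $\mathbb E$. For $\beta>0$ let \[Z_{\beta,N}=\sum_{\sigma\in\mathcal S_N}e^{\beta\sqrt N X_\sigma}\] be the partition function of the random energy model (REM). Let $(t_N)$ be a sequence of real numbers with $t_N\to\infty$, and put \[W_N=\frac{e^{\frac N2(\log 2-\beta^2)}}{t_N}\,\log\left(\frac{Z_{\beta,N}}{\mathbb E Z_{\beta,N}}\right).\] Real random variables $(Y_N)$ are said to satisfy the large deviation principle (LDP) with speed $\gamma_N\to\infty$ and lower semicontinuous rate function $I:\mathbb R\to[0,\infty]$ if for every Borel set $A\subseteq\mathbb R$ \[-\inf_{x\in A^\circ}I(x)\le\liminf_{N\to\infty}\frac1{\gamma_N}\log P(Y_N\in A)\le\limsup_{N\to\infty}\frac1{\gamma_N}\log P(Y_N\in A)\le-\inf_{x\in\overline A}I(x);\] $I$ is good if $\{x : I(x)\le c\}$ is compact for every $c\in\mathbb R$. (i) Let $\beta<\sqrt{\log 2/2}$.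 If $t_N=o(\sqrt N)$, then $(W_N)$ satisfies the LDP with speed $t_N^2$ and good rate function $I(x)=x^2/2$. If $\liminf_{N\to\infty}t_N/\sqrt N>0$, then $(W_N)$ satisfies the LDP with every speed $\gamma_N\to\infty$ such that $\gamma_N=o(N)$, with the good rate function $I(0)=0$, $I(x)=\infty$ for $x\ne0$. (ii) Let $\beta=\sqrt{\log 2/2}$. If $t_N=o(\sqrt{\log N})$, then $(W_N)$ satisfies the LDP with speed $t_N^2$ and good rate function $I(x)=x^2$. -/

import Mathlib

open MeasureTheory ProbabilityTheory Filter Asymptotics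
open scoped ENNReal Topology

noncomputable section

/-- The configuration space `{-1, +1}^N`. -/
abbrev SpinConfig (N : ℕ) : Type := Fin N → ℤˣ

/-- The large deviation principle, with speed `γ` and rate function `I`, for a sequence `Y` of
random variables with values in a Hausdorff space with its Borel σ-algebra. Logarithms of
probabilities are extended reals, with `log 0 = -∞`, and infima over `∅` are `+∞`. -/
structure SatisfiesLDP {Ω 𝓧 : Type*} [MeasurableSpace Ω] [TopologicalSpace 𝓧] [T2Space 𝓧]
    [MeasurableSpace 𝓧] [BorelSpace 𝓧] (P : Measure Ω) (Y : ℕ → Ω → 𝓧) (γ : ℕ → ℝ)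
    (I : 𝓧 → ℝ≥0∞) : Prop where
  measurable : ∀ n, Measurable (Y n)
  tendsto_speed : Tendsto γ atTop atTop
  lowerSemicontinuous : LowerSemicontinuous I
  lower_bound : ∀ A : Set 𝓧, MeasurableSet A →
    -(⨅ x ∈ interior A, (I x : EReal)) ≤
      liminf (fun n => (((γ n)⁻¹ : ℝ) : EReal) * ENNReal.log (P (Y n ⁻¹' A))) atTop
  upper_bound : ∀ A : Set 𝓧, MeasurableSet A →
    limsup (fun n => (((γ n)⁻¹ : ℝ) : EReal) * ENNReal.log (P (Y n ⁻¹' A))) atTop ≤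
      -(⨅ x ∈ closure A, (I x : EReal))

/-- A rate function is good if all its level sets are compact. -/
def IsGoodRate {𝓧 : Type*} [TopologicalSpace 𝓧] (I : 𝓧 → ℝ≥0∞) : Prop :=
  ∀ c : ℝ, IsCompact {x : 𝓧 | (I x : EReal) ≤ (c : EReal)}

namespace REM

/-- The disorder of the random energy model: for every `N`, the variables `X N σ`,
`σ ∈ {-1, +1}^N`, are independent standard Gaussian random variables. -/
structure IsDisorder {Ω : Type*} [MeasurableSpace Ω] (P : Measure Ω)
    (X : (N : ℕ) → SpinConfig N → Ω → ℝ) : Prop where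
  measurable : ∀ N σ, Measurable (X N σ)
  law : ∀ N σ, P.map (X N σ) = gaussianReal 0 1
  indep : ∀ N, iIndepFun (X N) P

/-- The partition function `Z_{β,N} = ∑_σ exp (β √N X_σ)`. -/
def partitionFunction {Ω : Type*} (X : (N : ℕ) → SpinConfig N → Ω → ℝ) (β : ℝ) (N : ℕ)
    (ω : Ω) : ℝ :=
  ∑ σ : SpinConfig N, Real.exp (β * √(N : ℝ) * X N σ ω)

/-- The rescaled fluctuation `e^{N (log 2 - β²) / 2} / t_N * log (Z_{β,N} / E Z_{β,N})`. -/
def rescaledFreeEnergy {Ω : Type*} [MeasurableSpace Ω] (P : Measure Ω)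
    (X : (N : ℕ) → SpinConfig N → Ω → ℝ) (β : ℝ) (t : ℕ → ℝ) (N : ℕ) (ω : Ω) : ℝ :=
  Real.exp ((N : ℝ) / 2 * (Real.log 2 - β ^ 2)) / t N *
    Real.log (partitionFunction X β N ω / ∫ ω', partitionFunction X β N ω' ∂P)

/-- The degenerate rate function: `0` at `0` and `∞` elsewhere. -/
def degenerateRate (x : ℝ) : ℝ≥0∞ := if x = 0 then 0 else ⊤

end REM

end

/-! With `b = β√N`, the ratio `Z/EZ` is the average over `2^N` independent copies of `exp (b X -
b²/2)`, whose second moment is `e^{b²}`. Put `a = e^{N(log 2 - β²)/2}`, so that `a²/2^N = e^{-b²}`.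
Then `a (Z/EZ - 1)` has variance close to 1, and on the scale `t` the expected rate is Gaussian.
These weights have no exponential moments, so they are cut off at a level `r N`. By a union bound,
the cut-off changes the sum only with probability at most `2^N P(X > r)`, which must be
superexponentially small at speed `t²`.

The truncated sum has logarithmic moment generating function `2^N log E exp(...)`; a second-order
Taylor expansion gives the limit `v l²/2`, where `v` is the proportion of the second moment lying
below the cut-off (`tendsto_mul_log_integral_exp_truncatedWeight`). A quadratic Gärtner–Ellis
argument (`satisfiesLDP_of_mgf`) turns this into the rate `x²/(2v)`. Off the exceptional event, the
truncated sum is `ψ(W) = (e^{hW} - 1)/h` with `h = t/a → 0`; this increasing map tends to the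
identity, so the logarithm costs nothing.

Squaring the weight tilts the Gaussian to mean `2b`, while the largest of the `X_σ` is near `√(2 log
2) √N`. For `β < √(log 2/2)` the level fits strictly above both, and `v = 1`. At equality the two
coincide to leading order; the level is placed slightly below `2b`, half of the second moment is
lost and `v = 1/2`. The degenerate case compares `t` with a smaller scale to which the first case
applies. -/

noncomputable section

/-! ### Criteria for large deviation principles in terms of real exponential bounds. -/

section LDP

variable {Ω : Type*} [MeasurableSpace Ω] {P : Measure Ω} [IsProbabilityMeasure P]

lemma inv_mul_log_le_of_real_le {A : Set Ω} {s c : ℝ} (hs : 0 < s)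
    (h : P.real A ≤ Real.exp (-(c * s))) :
    ((s⁻¹ : ℝ) : EReal) * ENNReal.log (P A) ≤ ((-c : ℝ) : EReal) := by
  have hP : P A ≤ ENNReal.ofReal (Real.exp (-(c * s))) := by
    rw [← ofReal_measureReal (μ := P) (s := A)]
    exact ENNReal.ofReal_le_ofReal h
  have h1 : ENNReal.log (P A) ≤ ((-(c * s) : ℝ) : EReal) := by
    refine (ENNReal.log_le_log hP).trans ?_
    rw [ENNReal.log_ofReal_of_pos (Real.exp_pos _), Real.log_exp]
  calc ((s⁻¹ : ℝ) : EReal) * ENNReal.log (P A)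
      ≤ ((s⁻¹ : ℝ) : EReal) * ((-(c * s) : ℝ) : EReal) := by
        refine mul_le_mul_of_nonneg_left h1 ?_
        exact_mod_cast (inv_pos.2 hs).le
    _ = ((-c : ℝ) : EReal) := by
        rw [← EReal.coe_mul]
        congr 1
        field_simp

lemma le_inv_mul_log_of_le_real {A : Set Ω} {s c : ℝ} (hs : 0 < s)
    (h : Real.exp (-(c * s)) ≤ P.real A) :
    ((-c : ℝ) : EReal) ≤ ((s⁻¹ : ℝ) : EReal) * ENNReal.log (P A) := by
  have hP : ENNReal.ofReal (Real.exp (-(c * s))) ≤ P A := by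
    rw [← ofReal_measureReal (μ := P) (s := A)]
    exact ENNReal.ofReal_le_ofReal h
  have h1 : ((-(c * s) : ℝ) : EReal) ≤ ENNReal.log (P A) := by
    refine le_trans ?_ (ENNReal.log_le_log hP)
    rw [ENNReal.log_ofReal_of_pos (Real.exp_pos _), Real.log_exp]
  calc ((-c : ℝ) : EReal) = ((s⁻¹ : ℝ) : EReal) * ((-(c * s) : ℝ) : EReal) := by
        rw [← EReal.coe_mul]
        congr 1
        field_simp
    _ ≤ ((s⁻¹ : ℝ) : EReal) * ENNReal.log (P A) := by
        refine mul_le_mul_of_nonneg_left h1 ?_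
        exact_mod_cast (inv_pos.2 hs).le

/-- The large deviation principle follows from exponential bounds on neighbourhoods and on sets
away from the small values of the rate function. -/
lemma satisfiesLDP_of_eventually {𝓧 : Type*} [TopologicalSpace 𝓧] [T2Space 𝓧]
    [MeasurableSpace 𝓧] [BorelSpace 𝓧] {Y : ℕ → Ω → 𝓧} {γ : ℕ → ℝ} {I : 𝓧 → ℝ≥0∞}
    (hY : ∀ n, Measurable (Y n)) (hγ : Tendsto γ atTop atTop) (hI : LowerSemicontinuous I)
    (hlow : ∀ x, ∀ U, IsOpen U → x ∈ U → ∀ c : ℝ, (I x : EReal) < c →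
      ∀ᶠ n in atTop, Real.exp (-(c * γ n)) ≤ P.real (Y n ⁻¹' U))
    (hup : ∀ A, MeasurableSet A → ∀ c : ℝ, 0 ≤ c → (∀ x ∈ closure A, (c : EReal) < I x) →
      ∀ c' < c, ∀ᶠ n in atTop, P.real (Y n ⁻¹' A) ≤ Real.exp (-(c' * γ n))) :
    SatisfiesLDP P Y γ I where
  measurable := hY
  tendsto_speed := hγ
  lowerSemicontinuous := hI
  lower_bound A _ := by
    rw [EReal.neg_le]
    refine le_iInf₂ fun x hx => ?_
    rw [EReal.neg_le, ← EReal.ge_of_forall_gt_iff_ge]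
    intro z hz
    have hz' : (I x : EReal) < ((-z : ℝ) : EReal) := by
      rw [EReal.coe_neg]
      exact EReal.lt_neg_comm.1 hz
    refine le_liminf_of_le (by isBoundedDefault) ?_
    filter_upwards [hlow x _ isOpen_interior hx (-z) hz', hγ.eventually_gt_atTop 0] with n hn hs
    have := le_inv_mul_log_of_le_real (A := Y n ⁻¹' A) hs
      (hn.trans (measureReal_mono (Set.preimage_mono interior_subset)))
    simpa using this
  upper_bound A hA := by
    rw [← EReal.le_of_forall_lt_iff_le]
    intro z hz
    rw [EReal.neg_lt_comm] at hz
    refine limsup_le_of_le (by isBoundedDefault) ?_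
    -- For positive `z` the bound only says that a probability is at most 1, so `hup` is needed for
    -- nonnegative levels alone.
    rcases lt_or_ge 0 z with h0 | h0
    · filter_upwards [hγ.eventually_gt_atTop 0] with n hs
      have h := inv_mul_log_le_of_real_le (P := P) (A := Y n ⁻¹' A) (c := 0) hs
        (by simp)
      refine h.trans ?_
      exact_mod_cast (by linarith : -(0 : ℝ) ≤ z)
    · obtain ⟨c, hc, hc'⟩ := EReal.lt_iff_exists_real_btwn.1 hz
      rw [← EReal.coe_neg, EReal.coe_lt_coe_iff] at hc
      filter_upwards [hup A hA c (by linarith)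
        (fun x hx => hc'.trans_le (iInf₂_le x hx)) (-z) hc, hγ.eventually_gt_atTop 0] with n hn hs
      simpa using inv_mul_log_le_of_real_le hs hn

lemma coe_ennreal_ofReal_of_nonneg {a : ℝ} (ha : 0 ≤ a) :
    ((ENNReal.ofReal a : ℝ≥0∞) : EReal) = (a : EReal) := by
  rw [EReal.coe_ennreal_ofReal, max_eq_left ha]

/-- Any loss in the exponential rate absorbs the factor 2 coming from a union of two events. -/
lemma eventually_two_mul_exp_le {γ : ℕ → ℝ} (hγ : Tendsto γ atTop atTop) {c c' : ℝ} (h : c' < c) :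
    ∀ᶠ n in atTop, 2 * Real.exp (-(c * γ n)) ≤ Real.exp (-(c' * γ n)) := by
  have h1 : Tendsto (fun n => (c - c') * γ n) atTop atTop :=
    hγ.const_mul_atTop (sub_pos.2 h)
  filter_upwards [h1.eventually_ge_atTop (Real.log 2)] with n hn
  calc 2 * Real.exp (-(c * γ n)) = Real.exp (Real.log 2) * Real.exp (-(c * γ n)) := by
        rw [Real.exp_log two_pos]
    _ = Real.exp (Real.log 2 + -(c * γ n)) := (Real.exp_add _ _).symm
    _ ≤ _ := Real.exp_le_exp.2 (by linarith)

/-- Exponential tail bounds and local lower bounds of quadratic order give a large deviation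
principle with a quadratic rate function. -/
lemma satisfiesLDP_of_tails {Y : ℕ → Ω → ℝ} {γ : ℕ → ℝ} {v : ℝ} (hv : 0 < v)
    (hY : ∀ n, Measurable (Y n)) (hγ : Tendsto γ atTop atTop)
    (hright : ∀ x > 0, ∀ c < x ^ 2 / (2 * v),
      ∀ᶠ n in atTop, P.real {ω | x ≤ Y n ω} ≤ Real.exp (-(c * γ n)))
    (hleft : ∀ x > 0, ∀ c < x ^ 2 / (2 * v),
      ∀ᶠ n in atTop, P.real {ω | Y n ω ≤ -x} ≤ Real.exp (-(c * γ n)))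
    (hlow : ∀ x x₁ x₂ : ℝ, x₁ < x → x < x₂ → ∀ c > x ^ 2 / (2 * v),
      ∀ᶠ n in atTop, Real.exp (-(c * γ n)) ≤ P.real {ω | x₁ < Y n ω ∧ Y n ω < x₂}) :
    SatisfiesLDP P Y γ (fun x : ℝ => ENNReal.ofReal (x ^ 2 / (2 * v))) := by
  refine satisfiesLDP_of_eventually hY hγ ?_ ?_ ?_
  · have : Continuous fun x : ℝ => ENNReal.ofReal (x ^ 2 / (2 * v)) :=
      ENNReal.continuous_ofReal.comp (by fun_prop)
    exact this.lowerSemicontinuous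
  · intro x U hU hx c hc
    rw [coe_ennreal_ofReal_of_nonneg (by positivity), EReal.coe_lt_coe_iff] at hc
    obtain ⟨ε, hε, hball⟩ := Metric.isOpen_iff.1 hU x hx
    filter_upwards [hlow x (x - ε) (x + ε) (by linarith) (by linarith) c hc] with n hn
    refine hn.trans (measureReal_mono fun ω hω => hball ?_)
    rw [Metric.mem_ball, Real.dist_eq, abs_lt]
    exact ⟨by linarith [hω.1], by linarith [hω.2]⟩
  · intro A _ c hc hAc c' hc'
    rcases hc.eq_or_lt with rfl | hc
    · filter_upwards [hγ.eventually_gt_atTop 0] with n hs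
      refine measureReal_le_one.trans (Real.one_le_exp ?_)
      nlinarith
    · obtain ⟨c'', h1, h2⟩ := exists_between hc'
      -- This is the radius at which the rate equals `c`; the closure of `A` lies outside it.
      have hr : 0 < √(2 * v * c) := Real.sqrt_pos.2 (by positivity)
      have hc2 : c'' < √(2 * v * c) ^ 2 / (2 * v) := by
        rw [Real.sq_sqrt (by positivity)]
        field_simp
        exact h2
      filter_upwards [hright _ hr c'' hc2, hleft _ hr c'' hc2,
        eventually_two_mul_exp_le hγ h1] with n hn1 hn2 hn3
      have hsub : Y n ⁻¹' A ⊆ {ω | √(2 * v * c) ≤ Y n ω} ∪ {ω | Y n ω ≤ -√(2 * v * c)} := by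
        intro ω hω
        have h3 := hAc _ (subset_closure hω)
        rw [coe_ennreal_ofReal_of_nonneg (by positivity), EReal.coe_lt_coe_iff,
          lt_div_iff₀ (by positivity)] at h3
        have h4 : √(2 * v * c) ≤ |Y n ω| := Real.sqrt_le_iff.2 ⟨abs_nonneg _, by
          rw [sq_abs]; linarith⟩
        rcases le_abs.1 h4 with h | h
        · exact Or.inl h
        · exact Or.inr (by simpa using le_neg_of_le_neg h)
      calc P.real (Y n ⁻¹' A) ≤ _ := measureReal_mono hsub
        _ ≤ _ := measureReal_union_le _ _
        _ ≤ 2 * Real.exp (-(c'' * γ n)) := by linarith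
        _ ≤ _ := hn3

/-- A sequence which leaves every neighbourhood of the origin with superexponentially small
probability satisfies the degenerate large deviation principle. -/
lemma satisfiesLDP_degenerateRate {Y : ℕ → Ω → ℝ} {γ : ℕ → ℝ}
    (hY : ∀ n, Measurable (Y n)) (hγ : Tendsto γ atTop atTop)
    (htail : ∀ x > 0, ∀ c : ℝ,
      ∀ᶠ n in atTop, P.real {ω | x ≤ |Y n ω|} ≤ Real.exp (-(c * γ n))) :
    SatisfiesLDP P Y γ REM.degenerateRate := by
  refine satisfiesLDP_of_eventually hY hγ ?_ ?_ ?_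
  · intro x y hy
    by_cases hx : x = 0
    · simp [hx, REM.degenerateRate] at hy
    · filter_upwards [isOpen_ne.mem_nhds hx] with z hz
      have hz : z ≠ 0 := hz
      simpa [REM.degenerateRate, hz, hx] using hy
  · intro x U hU hx c hc
    by_cases hx0 : x = 0
    · subst hx0
      have hc0 : 0 < c := by simpa [REM.degenerateRate] using hc
      obtain ⟨ε, hε, hball⟩ := Metric.isOpen_iff.1 hU 0 hx
      have h1 : Tendsto (fun n => c * γ n) atTop atTop := hγ.const_mul_atTop hc0
      filter_upwards [htail ε hε c, h1.eventually_ge_atTop (Real.log 2)] with n hn hn2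
      -- Once the complement has probability at most one half, so does the required lower bound on
      -- the neighbourhood.
      have h2 : Real.exp (-(c * γ n)) ≤ 1 / 2 := by
        calc Real.exp (-(c * γ n)) ≤ Real.exp (-(Real.log 2)) := Real.exp_le_exp.2 (by linarith)
          _ = 1 / 2 := by rw [Real.exp_neg, Real.exp_log two_pos]; norm_num
      have h3 : (Y n ⁻¹' U)ᶜ ⊆ {ω | ε ≤ |Y n ω|} := by
        intro ω hω
        by_contra hlt
        refine hω (hball ?_)
        simpa [Real.dist_eq] using hlt
      have h4 := measureReal_mono (μ := P) h3
      rw [measureReal_compl (hY n hU.measurableSet), probReal_univ] at h4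
      linarith
    · simp [REM.degenerateRate, hx0] at hc
  · intro A _ c hc hAc c' _
    have h0 : (0 : ℝ) ∈ (closure A)ᶜ := by
      intro h
      have := hAc 0 h
      simp only [REM.degenerateRate, if_true, EReal.coe_ennreal_zero] at this
      exact absurd hc (not_le.2 (by exact_mod_cast this))
    obtain ⟨ε, hε, hball⟩ := Metric.isOpen_iff.1 isClosed_closure.isOpen_compl 0 h0
    filter_upwards [htail ε hε c'] with n hn
    refine (measureReal_mono fun ω hω => ?_).trans hn
    by_contra hlt
    have hmem : Y n ω ∈ Metric.ball (0 : ℝ) ε := by simpa [Real.dist_eq] using hlt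
    exact hball hmem (subset_closure hω)

end LDP

/-! ### Goodness of the rate functions. -/

lemma isGoodRate_degenerateRate : IsGoodRate REM.degenerateRate := by
  intro c
  refine (isCompact_singleton (x := (0 : ℝ))).of_isClosed_subset ?_ ?_
  · by_cases hc : 0 ≤ c
    · convert isClosed_singleton (x := (0 : ℝ)) using 1
      ext x
      by_cases hx : x = 0 <;> simp [REM.degenerateRate, hx, hc]
    · convert isClosed_empty (X := ℝ) using 1
      ext x
      by_cases hx : x = 0
      · simpa [REM.degenerateRate, hx] using hc
      · simp [REM.degenerateRate, hx]
  · intro x hx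
    by_contra h
    have h : x ≠ 0 := h
    simp [REM.degenerateRate, h] at hx

lemma isGoodRate_sq_div {v : ℝ} (hv : 0 < v) :
    IsGoodRate (fun x : ℝ => ENNReal.ofReal (x ^ 2 / (2 * v))) := by
  intro c
  refine (ProperSpace.isCompact_closedBall (0 : ℝ) √(2 * v * c)).of_isClosed_subset ?_ ?_
  · have : {x : ℝ | ((ENNReal.ofReal (x ^ 2 / (2 * v)) : ℝ≥0∞) : EReal) ≤ (c : EReal)} =
        {x : ℝ | x ^ 2 / (2 * v) ≤ c} := by
      ext x
      simp only [Set.mem_ofPred_eq]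
      rw [coe_ennreal_ofReal_of_nonneg (by positivity), EReal.coe_le_coe_iff]
    rw [this]
    exact isClosed_le (by fun_prop) continuous_const
  · intro x hx
    simp only [Set.mem_ofPred_eq] at hx
    rw [coe_ennreal_ofReal_of_nonneg (by positivity), EReal.coe_le_coe_iff,
      div_le_iff₀ (by positivity)] at hx
    rw [mem_closedBall_zero_iff, Real.norm_eq_abs]
    exact Real.abs_le_sqrt (by linarith)

/-! ### Gärtner–Ellis argument for a quadratic limiting cumulant function. -/

section QuadraticMGF

variable {Ω : Type*} [MeasurableSpace Ω] {P : Measure Ω} [IsProbabilityMeasure P]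

lemma eventually_mgf_bounds {V : ℕ → Ω → ℝ} {s : ℕ → ℝ} {v : ℝ}
    (hs : Tendsto s atTop atTop)
    (hint : ∀ n l, Integrable (fun ω => Real.exp (l * V n ω)) P)
    (hmgf : ∀ l : ℝ, Tendsto (fun n => Real.log (mgf (V n) P (l * s n)) / s n) atTop
      (𝓝 (v * l ^ 2 / 2))) (l : ℝ) {ε : ℝ} (hε : 0 < ε) :
    ∀ᶠ n in atTop, Real.exp (s n * (v * l ^ 2 / 2 - ε)) ≤ mgf (V n) P (l * s n) ∧
      mgf (V n) P (l * s n) ≤ Real.exp (s n * (v * l ^ 2 / 2 + ε)) := by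
  filter_upwards [(hmgf l).eventually (Ioo_mem_nhds (sub_lt_self _ hε) (lt_add_of_pos_right _ hε)),
    hs.eventually_gt_atTop 0] with n hn hsn
  have hpos : 0 < mgf (V n) P (l * s n) := mgf_pos (hint n _)
  rw [lt_div_iff₀ hsn, div_lt_iff₀ hsn] at hn
  constructor
  · rw [← Real.le_log_iff_exp_le hpos]
    linarith [hn.1]
  · rw [← Real.log_le_iff_le_exp hpos]
    linarith [hn.2]

lemma eventually_right_tail_le {V : ℕ → Ω → ℝ} {s : ℕ → ℝ} {v : ℝ} (hv : 0 < v)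
    (hs : Tendsto s atTop atTop)
    (hint : ∀ n l, Integrable (fun ω => Real.exp (l * V n ω)) P)
    (hmgf : ∀ l : ℝ, Tendsto (fun n => Real.log (mgf (V n) P (l * s n)) / s n) atTop
      (𝓝 (v * l ^ 2 / 2))) {x : ℝ} (hx : 0 < x) {c : ℝ} (hc : c < x ^ 2 / (2 * v)) :
    ∀ᶠ n in atTop, P.real {ω | x ≤ V n ω} ≤ Real.exp (-(c * s n)) := by
  -- Chernoff's bound at the minimiser `x / v` of `v l²/2 - l x`; the error allowed in the cumulant
  -- is exactly the gap between `c` and the optimal rate.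
  filter_upwards [eventually_mgf_bounds hs hint hmgf (x / v) (sub_pos.2 hc),
    hs.eventually_gt_atTop 0] with n hn hsn
  have h0 : 0 ≤ x / v * s n := by positivity
  calc P.real {ω | x ≤ V n ω}
      ≤ Real.exp (-(x / v * s n) * x) * mgf (V n) P (x / v * s n) :=
        measure_ge_le_exp_mul_mgf x h0 (hint n _)
    _ ≤ Real.exp (-(x / v * s n) * x) *
        Real.exp (s n * (v * (x / v) ^ 2 / 2 + (x ^ 2 / (2 * v) - c))) := by
        gcongr
        exact hn.2
    _ = Real.exp (-(c * s n)) := by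
        rw [← Real.exp_add]
        congr 1
        field_simp
        ring

lemma eventually_left_tail_le {V : ℕ → Ω → ℝ} {s : ℕ → ℝ} {v : ℝ} (hv : 0 < v)
    (hs : Tendsto s atTop atTop)
    (hint : ∀ n l, Integrable (fun ω => Real.exp (l * V n ω)) P)
    (hmgf : ∀ l : ℝ, Tendsto (fun n => Real.log (mgf (V n) P (l * s n)) / s n) atTop
      (𝓝 (v * l ^ 2 / 2))) {x : ℝ} (hx : 0 < x) {c : ℝ} (hc : c < x ^ 2 / (2 * v)) :
    ∀ᶠ n in atTop, P.real {ω | V n ω ≤ -x} ≤ Real.exp (-(c * s n)) := by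
  have h := eventually_right_tail_le (P := P) (V := fun n => -V n) hv hs
    (fun n l => by simpa using hint n (-l))
    (fun l => by simpa [mgf_neg] using hmgf (-l)) hx hc
  filter_upwards [h] with n hn
  simpa [le_neg] using hn

/-- This does the work of a change of measure without introducing the tilted law. To the right of
the window `e^{lV} ≤ e^{-h(x+δ)} e^{(l+h)V}`, and symmetrically to the left with `l - h`; inside it
`e^{lV}` is bounded by a constant. If the outer terms are negligible, the tilted mass sits in the
window. -/
lemma mgf_le_window_add {V : Ω → ℝ} (hV : Measurable V)
    (hint : ∀ l, Integrable (fun ω => Real.exp (l * V ω)) P) (l h x δ : ℝ) (hh : 0 ≤ h) :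
    mgf V P l ≤ Real.exp (l * x + |l| * δ) * P.real {ω | x - δ < V ω ∧ V ω < x + δ} +
      Real.exp (-(h * (x + δ))) * mgf V P (l + h) + Real.exp (h * (x - δ)) * mgf V P (l - h) := by
  have hB : MeasurableSet {ω | x - δ < V ω ∧ V ω < x + δ} :=
    (measurableSet_lt measurable_const hV).inter (measurableSet_lt hV measurable_const)
  have h1 : Integrable ({ω | x - δ < V ω ∧ V ω < x + δ}.indicator
      fun _ => Real.exp (l * x + |l| * δ)) P := (integrable_const _).indicator hB
  have h2 := (hint (l + h)).const_mul (Real.exp (-(h * (x + δ))))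
  have h3 := (hint (l - h)).const_mul (Real.exp (h * (x - δ)))
  calc mgf V P l = ∫ ω, Real.exp (l * V ω) ∂P := rfl
    _ ≤ ∫ ω, (({ω | x - δ < V ω ∧ V ω < x + δ}.indicator
          (fun _ => Real.exp (l * x + |l| * δ)) ω +
          Real.exp (-(h * (x + δ))) * Real.exp ((l + h) * V ω)) +
          Real.exp (h * (x - δ)) * Real.exp ((l - h) * V ω)) ∂P := by
        refine integral_mono (hint l) ((h1.add h2).add h3) fun ω => ?_
        simp only [← Real.exp_add]
        by_cases hω : x - δ < V ω ∧ V ω < x + δ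
        · rw [Set.indicator_of_mem (by exact hω)]
          have h4 : l * V ω ≤ l * x + |l| * δ := by
            have h5 : l * (V ω - x) ≤ |l| * δ := by
              refine (le_abs_self _).trans ?_
              rw [abs_mul]
              refine mul_le_mul_of_nonneg_left ?_ (abs_nonneg l)
              exact abs_le.2 ⟨by linarith [hω.1], by linarith [hω.2]⟩
            linarith
          have := Real.exp_le_exp.2 h4
          have := Real.exp_pos (-(h * (x + δ)) + (l + h) * V ω)
          have := Real.exp_pos (h * (x - δ) + (l - h) * V ω)
          linarith
        · rw [Set.indicator_of_notMem (by exact hω), zero_add]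
          have p1 := Real.exp_pos (-(h * (x + δ)) + (l + h) * V ω)
          have p2 := Real.exp_pos (h * (x - δ) + (l - h) * V ω)
          rcases lt_or_ge (x - δ) (V ω) with h6 | h6
          · have h7 : x + δ ≤ V ω := not_lt.1 fun h7 => hω ⟨h6, h7⟩
            have := Real.exp_le_exp.2 (show l * V ω ≤ -(h * (x + δ)) + (l + h) * V ω by
              nlinarith)
            linarith
          · have := Real.exp_le_exp.2 (show l * V ω ≤ h * (x - δ) + (l - h) * V ω by
              nlinarith)
            linarith
    _ = _ := by
        have h12 : Integrable (fun ω => {ω | x - δ < V ω ∧ V ω < x + δ}.indicator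
          (fun _ => Real.exp (l * x + |l| * δ)) ω +
          Real.exp (-(h * (x + δ))) * Real.exp ((l + h) * V ω)) P := h1.add h2
        rw [integral_add h12 h3, integral_add h1 h2, integral_indicator_const _ hB,
          integral_const_mul, integral_const_mul, smul_eq_mul, mul_comm (P.real _)]
        rfl

lemma eventually_exp_le_window {V : ℕ → Ω → ℝ} {s : ℕ → ℝ} {v : ℝ} (hv : 0 < v)
    (hV : ∀ n, Measurable (V n)) (hs : Tendsto s atTop atTop)
    (hint : ∀ n l, Integrable (fun ω => Real.exp (l * V n ω)) P)
    (hmgf : ∀ l : ℝ, Tendsto (fun n => Real.log (mgf (V n) P (l * s n)) / s n) atTop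
      (𝓝 (v * l ^ 2 / 2))) {x x₁ x₂ : ℝ} (h₁ : x₁ < x) (h₂ : x < x₂) {c : ℝ}
    (hc : x ^ 2 / (2 * v) < c) :
    ∀ᶠ n in atTop, Real.exp (-(c * s n)) ≤ P.real {ω | x₁ < V n ω ∧ V n ω < x₂} := by
  -- The two corrections are the oscillation of the tilt over the window and the term `2 * ε` lost
  -- to the cumulant error and the factor 2 below.
  obtain ⟨δ, hδ, hδ₁, hδ₂, hδc⟩ : ∃ δ > 0, x₁ ≤ x - δ ∧ x + δ ≤ x₂ ∧
      x ^ 2 / (2 * v) + |x / v| * δ + δ ^ 2 / (4 * v) < c := by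
    have e1 : ∀ᶠ δ in 𝓝[>] (0 : ℝ), x ^ 2 / (2 * v) + |x / v| * δ + δ ^ 2 / (4 * v) < c := by
      have : Tendsto (fun δ : ℝ => x ^ 2 / (2 * v) + |x / v| * δ + δ ^ 2 / (4 * v)) (𝓝[>] 0)
          (𝓝 (x ^ 2 / (2 * v) + |x / v| * 0 + 0 ^ 2 / (4 * v))) := by
        refine Tendsto.mono_left (Continuous.tendsto ?_ 0) nhdsWithin_le_nhds
        fun_prop
      exact this.eventually (gt_mem_nhds (by simpa using hc))
    have e2 : ∀ᶠ δ in 𝓝[>] (0 : ℝ), δ < min (x - x₁) (x₂ - x) :=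
      nhdsWithin_le_nhds (gt_mem_nhds (lt_min (sub_pos.2 h₁) (sub_pos.2 h₂)))
    obtain ⟨δ, ⟨h3, h4⟩, h5⟩ := ((e1.and e2).and self_mem_nhdsWithin).exists
    rw [lt_min_iff] at h4
    exact ⟨δ, h5, by linarith [h4.1], by linarith [h4.2], h3⟩
  -- The tilt `x / v` centres the law at `x`, and the shift `δ / v` is optimal for leaving the
  -- window. It gains `δ² / (2v) = 4ε`; the cumulant error takes back one `ε`, so each outer term is
  -- at most `e^{s(A - 3ε)}` against a total of at least `e^{s(A - ε)}`.
  set l := x / v with hl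
  set h := δ / v with hh
  set ε := δ ^ 2 / (8 * v) with hε
  have hεpos : 0 < ε := by positivity
  have hgap : Tendsto (fun n => 2 * ε * s n) atTop atTop :=
    hs.const_mul_atTop (by positivity)
  filter_upwards [eventually_mgf_bounds hs hint hmgf l hεpos,
    eventually_mgf_bounds hs hint hmgf (l + h) hεpos,
    eventually_mgf_bounds hs hint hmgf (l - h) hεpos, hs.eventually_gt_atTop 0,
    hgap.eventually_ge_atTop (Real.log 4),
    (hs.const_mul_atTop hεpos).eventually_ge_atTop (Real.log 2)] with n b1 b2 b3 hsn hn4 hn2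
  set A := v * l ^ 2 / 2 with hA
  set B := P.real {ω | x - δ < V n ω ∧ V n ω < x + δ} with hB
  have key := mgf_le_window_add (hV n) (hint n) (l * s n) (h * s n) x δ (by positivity)
  rw [← add_mul, ← sub_mul, ← hB] at key
  have e2 : Real.exp (-(h * s n * (x + δ))) * mgf (V n) P ((l + h) * s n) ≤
      Real.exp (s n * (A - 3 * ε)) := by
    refine (mul_le_mul_of_nonneg_left b2.2 (Real.exp_pos _).le).trans ?_
    rw [← Real.exp_add]
    refine Real.exp_le_exp.2 (le_of_eq ?_)
    rw [hA, hε, hh, hl]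
    field_simp
    ring
  have e3 : Real.exp (h * s n * (x - δ)) * mgf (V n) P ((l - h) * s n) ≤
      Real.exp (s n * (A - 3 * ε)) := by
    refine (mul_le_mul_of_nonneg_left b3.2 (Real.exp_pos _).le).trans ?_
    rw [← Real.exp_add]
    refine Real.exp_le_exp.2 (le_of_eq ?_)
    rw [hA, hε, hh, hl]
    field_simp
    ring
  have e4 : 4 * Real.exp (s n * (A - 3 * ε)) ≤ Real.exp (s n * (A - ε)) := by
    calc 4 * Real.exp (s n * (A - 3 * ε))
        = Real.exp (Real.log 4) * Real.exp (s n * (A - 3 * ε)) := by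
          rw [Real.exp_log (by norm_num)]
      _ = Real.exp (Real.log 4 + s n * (A - 3 * ε)) := (Real.exp_add _ _).symm
      _ ≤ _ := Real.exp_le_exp.2 (by linarith)
  have e5 : 2 * Real.exp (s n * (A - 2 * ε)) ≤ Real.exp (s n * (A - ε)) := by
    calc 2 * Real.exp (s n * (A - 2 * ε))
        = Real.exp (Real.log 2) * Real.exp (s n * (A - 2 * ε)) := by
          rw [Real.exp_log (by norm_num)]
      _ = Real.exp (Real.log 2 + s n * (A - 2 * ε)) := (Real.exp_add _ _).symm
      _ ≤ _ := Real.exp_le_exp.2 (by linarith)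
  have e6 : Real.exp (s n * (A - 2 * ε)) ≤ Real.exp (l * s n * x + |l * s n| * δ) * B := by
    linarith [b1.1]
  have e7 : B ≤ P.real {ω | x₁ < V n ω ∧ V n ω < x₂} :=
    measureReal_mono fun ω hω => ⟨hδ₁.trans_lt hω.1, hω.2.trans_le hδ₂⟩
  refine le_trans ?_ e7
  rw [mul_comm _ B, ← div_le_iff₀ (Real.exp_pos _), ← Real.exp_sub] at e6
  refine le_trans (Real.exp_le_exp.2 ?_) e6
  rw [abs_mul, abs_of_pos hsn]
  have e8 : A - 2 * ε - l * x - |l| * δ = -(x ^ 2 / (2 * v) + |l| * δ + δ ^ 2 / (4 * v)) := by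
    rw [hA, hε, hl]
    field_simp
    ring
  nlinarith [mul_lt_mul_of_pos_right hδc hsn]

/-- A large deviation principle from the asymptotics of the moment generating functions of
auxiliary variables, which determine the variables of interest outside a superexponentially
unlikely event. -/
lemma satisfiesLDP_of_mgf {V Y : ℕ → Ω → ℝ} {s : ℕ → ℝ} {v : ℝ} (hv : 0 < v)
    (hV : ∀ n, Measurable (V n)) (hY : ∀ n, Measurable (Y n)) (hs : Tendsto s atTop atTop)
    (hint : ∀ n l, Integrable (fun ω => Real.exp (l * V n ω)) P)
    (hmgf : ∀ l : ℝ, Tendsto (fun n => Real.log (mgf (V n) P (l * s n)) / s n) atTop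
      (𝓝 (v * l ^ 2 / 2)))
    (bad : ℕ → Set Ω)
    (hbad : ∀ c : ℝ, ∀ᶠ n in atTop, P.real (bad n) ≤ Real.exp (-(c * s n)))
    (ψ : ℕ → ℝ → ℝ) (hψ : ∀ x, Tendsto (fun n => ψ n x) atTop (𝓝 x))
    (hVY : ∀ᶠ n in atTop, StrictMono (ψ n) ∧ ∀ ω ∉ bad n, V n ω = ψ n (Y n ω)) :
    SatisfiesLDP P Y s (fun x : ℝ => ENNReal.ofReal (x ^ 2 / (2 * v))) := by
  have hcont : ∀ x c : ℝ, 0 < x → c < x ^ 2 / (2 * v) →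
      ∃ y, 0 < y ∧ y < x ∧ c < y ^ 2 / (2 * v) := by
    intro x c hx hc
    have e1 : ∀ᶠ y in 𝓝[<] x, c < y ^ 2 / (2 * v) := by
      have : Tendsto (fun y : ℝ => y ^ 2 / (2 * v)) (𝓝[<] x) (𝓝 (x ^ 2 / (2 * v))) :=
        Tendsto.mono_left (Continuous.tendsto (by fun_prop) x) nhdsWithin_le_nhds
      exact this.eventually (lt_mem_nhds hc)
    have e2 : ∀ᶠ y in 𝓝[<] x, 0 < y := nhdsWithin_le_nhds (lt_mem_nhds hx)
    obtain ⟨y, ⟨h3, h4⟩, h5⟩ := ((e1.and e2).and self_mem_nhdsWithin).exists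
    exact ⟨y, h4, h5, h3⟩
  refine satisfiesLDP_of_tails hv hY hs ?_ ?_ ?_
  · intro x hx c hc
    obtain ⟨y, hy, hyx, hcy⟩ := hcont x c hx hc
    obtain ⟨c', hc', hc''⟩ := exists_between hcy
    filter_upwards [eventually_right_tail_le hv hs hint hmgf hy hc'', hbad c',
      eventually_two_mul_exp_le hs hc', hVY, (hψ x).eventually (lt_mem_nhds hyx)]
      with n h1 h2 h3 h4 h5
    -- Monotonicity of `ψ n` carries half-lines to half-lines, so convergence at the single point
    -- `x` suffices.
    have hsub : {ω | x ≤ Y n ω} ⊆ {ω | y ≤ V n ω} ∪ bad n := by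
      intro ω hω
      by_cases hb : ω ∈ bad n
      · exact Or.inr hb
      · refine Or.inl ?_
        have : ψ n x ≤ ψ n (Y n ω) := h4.1.monotone hω
        rw [← h4.2 ω hb] at this
        exact h5.le.trans this
    have := (measureReal_mono (μ := P) hsub).trans (measureReal_union_le _ _)
    linarith
  · intro x hx c hc
    obtain ⟨y, hy, hyx, hcy⟩ := hcont x c hx hc
    obtain ⟨c', hc', hc''⟩ := exists_between hcy
    filter_upwards [eventually_left_tail_le hv hs hint hmgf hy hc'', hbad c',
      eventually_two_mul_exp_le hs hc', hVY,
      (hψ (-x)).eventually (gt_mem_nhds (neg_lt_neg hyx))] with n h1 h2 h3 h4 h5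
    have hsub : {ω | Y n ω ≤ -x} ⊆ {ω | V n ω ≤ -y} ∪ bad n := by
      intro ω hω
      by_cases hb : ω ∈ bad n
      · exact Or.inr hb
      · refine Or.inl ?_
        have : ψ n (Y n ω) ≤ ψ n (-x) := h4.1.monotone hω
        rw [← h4.2 ω hb] at this
        exact this.trans h5.le
    have := (measureReal_mono (μ := P) hsub).trans (measureReal_union_le _ _)
    linarith
  · intro x x₁ x₂ hx₁ hx₂ c hc
    obtain ⟨y₁, hy₁, hy₁'⟩ := exists_between hx₁
    obtain ⟨y₂, hy₂, hy₂'⟩ := exists_between hx₂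
    obtain ⟨c', hc', hc''⟩ := exists_between hc
    -- The window has probability at least `2 * exp (-(c * s n))` and the bad event takes away at
    -- most half of that.
    filter_upwards [eventually_exp_le_window hv hV hs hint hmgf hy₁' hy₂ hc', hbad c,
      eventually_two_mul_exp_le hs hc'', hVY, (hψ x₁).eventually (gt_mem_nhds hy₁),
      (hψ x₂).eventually (lt_mem_nhds hy₂')] with n h1 h2 h3 h4 h5 h6
    have hsub : {ω | y₁ < V n ω ∧ V n ω < y₂} ⊆
        {ω | x₁ < Y n ω ∧ Y n ω < x₂} ∪ bad n := by
      intro ω hω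
      by_cases hb : ω ∈ bad n
      · exact Or.inr hb
      · refine Or.inl ?_
        have hω' := hω
        simp only [Set.mem_ofPred_eq, h4.2 ω hb] at hω'
        exact ⟨h4.1.lt_iff_lt.1 (h5.trans hω'.1), h4.1.lt_iff_lt.1 (hω'.2.trans h6)⟩
    have := (measureReal_mono (μ := P) hsub).trans (measureReal_union_le _ _)
    linarith

end QuadraticMGF

/-! ### Gaussian tilting and tail estimates. -/

section GaussianTail

/-- The tail of the standard Gaussian distribution. -/
def gaussianTail (r : ℝ) : ℝ := (gaussianReal 0 1).real (Set.Ioi r)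

lemma gaussianTail_nonneg (r : ℝ) : 0 ≤ gaussianTail r := measureReal_nonneg

/-- Completing the square: the exponential weight is the density of a translated Gaussian
(Cameron–Martin). -/
lemma integral_mul_exp_gaussianReal (f : ℝ → ℝ) (b : ℝ) :
    ∫ x, f x * Real.exp (b * x - b ^ 2 / 2) ∂(gaussianReal 0 1) = ∫ x, f x ∂(gaussianReal b 1) := by
  rw [integral_gaussianReal_eq_integral_smul one_ne_zero,
    integral_gaussianReal_eq_integral_smul one_ne_zero]
  congr 1 with x
  simp only [gaussianPDFReal, smul_eq_mul, NNReal.coe_one, mul_one, sub_zero]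
  have h : Real.exp (-(x - b) ^ 2 / 2) =
      Real.exp (-x ^ 2 / 2) * Real.exp (b * x - b ^ 2 / 2) := by
    rw [← Real.exp_add]
    congr 1
    ring
  rw [h]
  ring

lemma gaussianReal_real_Ioi (b r : ℝ) :
    (gaussianReal b 1).real (Set.Ioi r) = gaussianTail (r - b) := by
  have h : gaussianReal b 1 = (gaussianReal 0 1).map (· + b) := by
    rw [gaussianReal_map_add_const, zero_add]
  rw [h, map_measureReal_apply (by fun_prop) measurableSet_Ioi, gaussianTail]
  congr 1
  ext x
  simp [sub_lt_iff_lt_add]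

lemma integral_indicator_Iic_mul_exp (b r : ℝ) :
    ∫ x, (Set.Iic r).indicator 1 x * Real.exp (b * x - b ^ 2 / 2) ∂(gaussianReal 0 1) =
      1 - gaussianTail (r - b) := by
  rw [integral_mul_exp_gaussianReal, integral_indicator_one measurableSet_Iic,
    ← gaussianReal_real_Ioi, ← Set.compl_Iic, measureReal_compl measurableSet_Iic, probReal_univ]
  ring

lemma integrable_mul_exp_neg_sq_Ioi_and (r : ℝ) (hr : 0 ≤ r) :
    IntegrableOn (fun x : ℝ => x * Real.exp (-x ^ 2 / 2)) (Set.Ioi r) ∧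
      ∫ x in Set.Ioi r, x * Real.exp (-x ^ 2 / 2) = Real.exp (-r ^ 2 / 2) := by
  have hd : ∀ x ∈ Set.Ici r, HasDerivAt (fun x : ℝ => -Real.exp (-x ^ 2 / 2))
      (x * Real.exp (-x ^ 2 / 2)) x := by
    intro x _
    have h1 : HasDerivAt (fun x : ℝ => -x ^ 2 / 2) (-x) x := by
      refine (((hasDerivAt_pow 2 x).neg).div_const 2).congr_deriv ?_
      norm_num
      ring
    exact h1.exp.neg.congr_deriv (by ring)
  have hlim : Tendsto (fun x : ℝ => -Real.exp (-x ^ 2 / 2)) atTop (𝓝 0) := by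
    rw [← neg_zero]
    refine (Real.tendsto_exp_atBot.comp ?_).neg
    have : Tendsto (fun x : ℝ => x ^ 2 * (1 / 2)) atTop atTop :=
      (tendsto_pow_atTop two_ne_zero).atTop_mul_const (by norm_num)
    exact (tendsto_neg_atTop_atBot.comp this).congr fun x => by
      simp only [Function.comp]
      ring
  have hpos : ∀ x ∈ Set.Ioi r, 0 ≤ x * Real.exp (-x ^ 2 / 2) := fun x hx =>
    mul_nonneg (hr.trans (le_of_lt hx)) (Real.exp_pos _).le
  refine ⟨integrableOn_Ioi_deriv_of_nonneg' hd hpos hlim, ?_⟩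
  rw [integral_Ioi_of_hasDerivAt_of_nonneg' hd hpos hlim]
  ring

/-- Mills' bound: inserting the factor `x / r ≥ 1` makes the integrand an exact derivative. The
factor `1 / r` is kept because the critical case depends on it. -/
lemma gaussianTail_le {r : ℝ} (hr : 0 < r) : gaussianTail r ≤ Real.exp (-r ^ 2 / 2) / r := by
  obtain ⟨hi, he⟩ := integrable_mul_exp_neg_sq_Ioi_and r hr.le
  have h1 : gaussianTail r = ∫ x in Set.Ioi r, gaussianPDFReal 0 1 x := by
    rw [gaussianTail, measureReal_def, gaussianReal_apply_eq_integral _ one_ne_zero,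
      ENNReal.toReal_ofReal]
    exact integral_nonneg fun x => gaussianPDFReal_nonneg _ _ _
  rw [h1, ← he, ← integral_div]
  refine setIntegral_mono_on (integrable_gaussianPDFReal 0 1).integrableOn (hi.div_const r)
    measurableSet_Ioi fun x hx => ?_
  have hx : r < x := hx
  simp only [gaussianPDFReal, NNReal.coe_one, mul_one, sub_zero]
  have h2 : (√(2 * Real.pi))⁻¹ ≤ 1 := by
    refine inv_le_one_of_one_le₀ (Real.one_le_sqrt.2 ?_)
    linarith [Real.pi_gt_three]
  have h3 : 1 ≤ x / r := (one_le_div hr).2 hx.le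
  calc (√(2 * Real.pi))⁻¹ * Real.exp (-x ^ 2 / 2)
      ≤ x / r * Real.exp (-x ^ 2 / 2) :=
        mul_le_mul_of_nonneg_right (h2.trans h3) (Real.exp_pos _).le
    _ = _ := by ring

lemma gaussianTail_zero : gaussianTail 0 = 1 / 2 := by
  have h0 := nullSingletonClass_gaussianReal (μ := 0) (v := 1) one_ne_zero
  have h1 : (gaussianReal 0 1).real (Set.Iic 0) = gaussianTail 0 := by
    have h : gaussianReal 0 1 = (gaussianReal 0 1).map (fun x => -x) := by
      rw [gaussianReal_map_neg, neg_zero]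
    conv_lhs => rw [h]
    rw [map_measureReal_apply (by fun_prop) measurableSet_Iic, gaussianTail]
    refine measureReal_congr ?_
    have : (fun x : ℝ => -x) ⁻¹' Set.Iic 0 = Set.Ici 0 := by
      ext x
      simp
    rw [this]
    exact Ioi_ae_eq_Ici.symm
  have h2 := measureReal_compl (μ := gaussianReal 0 1) (measurableSet_Iic (a := (0 : ℝ)))
  rw [Set.compl_Iic, probReal_univ, h1] at h2
  change gaussianTail 0 = _ at h2
  linarith

/-- By dominated convergence, since the Gaussian has no atom at 0. This yields the factor one half
at the critical temperature. -/
lemma tendsto_gaussianTail_zero {ι : Type*} {l : Filter ι} [l.IsCountablyGenerated] {z : ι → ℝ}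
    (hz : Tendsto z l (𝓝 0)) :
    Tendsto (fun n => gaussianTail (z n)) l (𝓝 (1 / 2)) := by
  have h0 := nullSingletonClass_gaussianReal (μ := 0) (v := 1) one_ne_zero
  have h : ∀ r, gaussianTail r = ∫ x, (Set.Ioi r).indicator (1 : ℝ → ℝ) x ∂(gaussianReal 0 1) :=
    fun r => (integral_indicator_one measurableSet_Ioi).symm
  rw [← gaussianTail_zero]
  simp only [h]
  refine tendsto_integral_filter_of_dominated_convergence (fun _ => 1) ?_ ?_
    (integrable_const _) ?_
  · exact Eventually.of_forall fun n =>
      (measurable_one.indicator measurableSet_Ioi).aestronglyMeasurable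
  · refine Eventually.of_forall fun n => Eventually.of_forall fun x => ?_
    by_cases hx : x ∈ Set.Ioi (z n) <;> simp [hx]
  · have hne : ∀ᵐ x ∂(gaussianReal 0 1), x ≠ 0 := by
      rw [ae_iff]
      simp
    filter_upwards [hne] with x hx
    refine tendsto_const_nhds.congr' ?_
    rcases lt_or_gt_of_ne hx with hx | hx
    · filter_upwards [hz.eventually (lt_mem_nhds hx)] with n hn
      simp [hn.not_gt, hx.not_gt]
    · filter_upwards [hz.eventually (gt_mem_nhds hx)] with n hn
      simp [hn, hx]

lemma tendsto_gaussianTail_atTop {ι : Type*} {l : Filter ι} {z : ι → ℝ} (hz : Tendsto z l atTop) :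
    Tendsto (fun n => gaussianTail (z n)) l (𝓝 0) := by
  refine squeeze_zero' (Eventually.of_forall fun n => gaussianTail_nonneg _) ?_
    (tendsto_inv_atTop_zero.comp hz)
  filter_upwards [hz.eventually_gt_atTop 0] with n hn
  refine (gaussianTail_le hn).trans ?_
  rw [Function.comp, ← one_div]
  gcongr
  rw [Real.exp_le_one_iff]
  have := sq_nonneg (z n)
  linarith

end GaussianTail

/-! ### Moments and cumulants of a single truncated Boltzmann weight. -/

section TruncatedWeight

/-- The density of `gaussianReal b 1` with respect to the standard Gaussian distribution, set to
zero above the level `r`. -/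
def truncatedWeight (b r x : ℝ) : ℝ :=
  (Set.Iic r).indicator 1 x * Real.exp (b * x - b ^ 2 / 2)

@[fun_prop]
lemma measurable_truncatedWeight (b r : ℝ) : Measurable (truncatedWeight b r) := by
  unfold truncatedWeight
  exact (measurable_one.indicator measurableSet_Iic).mul (by fun_prop)

lemma truncatedWeight_nonneg (b r x : ℝ) : 0 ≤ truncatedWeight b r x :=
  mul_nonneg (Set.indicator_nonneg (fun _ _ => zero_le_one) x) (Real.exp_pos _).le

lemma truncatedWeight_of_le {b r x : ℝ} (h : x ≤ r) :
    truncatedWeight b r x = Real.exp (b * x - b ^ 2 / 2) := by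
  simp [truncatedWeight, h]

lemma truncatedWeight_le {b : ℝ} (hb : 0 ≤ b) (r x : ℝ) :
    truncatedWeight b r x ≤ Real.exp (b * r - b ^ 2 / 2) := by
  by_cases h : x ≤ r
  · rw [truncatedWeight_of_le h]
    gcongr
  · simp [truncatedWeight, h, Real.exp_nonneg]

lemma abs_truncatedWeight_sub_one_le {b : ℝ} (hb : 0 ≤ b) (r x : ℝ) :
    |truncatedWeight b r x - 1| ≤ Real.exp (b * r - b ^ 2 / 2) + 1 := by
  have h1 := truncatedWeight_nonneg b r x
  have h2 := truncatedWeight_le hb r x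
  rw [abs_le]
  constructor <;> linarith

lemma integrable_comp_truncatedWeight {b : ℝ} (hb : 0 ≤ b) (r : ℝ) {f : ℝ → ℝ}
    (hf : Continuous f) : Integrable (fun x => f (truncatedWeight b r x)) (gaussianReal 0 1) := by
  obtain ⟨C, hC⟩ := (isCompact_Icc (a := (0 : ℝ))
    (b := Real.exp (b * r - b ^ 2 / 2))).exists_bound_of_continuousOn hf.continuousOn
  refine Integrable.of_bound (hf.measurable.comp
    (measurable_truncatedWeight b r)).aestronglyMeasurable C (Eventually.of_forall fun x => ?_)
  exact hC _ ⟨truncatedWeight_nonneg b r x, truncatedWeight_le hb r x⟩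

lemma integral_truncatedWeight (b r : ℝ) :
    ∫ x, truncatedWeight b r x ∂(gaussianReal 0 1) = 1 - gaussianTail (r - b) :=
  integral_indicator_Iic_mul_exp b r

/-- The square of the weight is `e^{b²}` times the density of the Gaussian centred at `2b`, so the
cut-off removes the fraction `gaussianTail (r - 2 * b)` of the second moment. -/
lemma integral_truncatedWeight_sq (b r : ℝ) :
    ∫ x, truncatedWeight b r x ^ 2 ∂(gaussianReal 0 1) =
      Real.exp (b ^ 2) * (1 - gaussianTail (r - 2 * b)) := by
  rw [← integral_indicator_Iic_mul_exp, ← integral_const_mul]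
  congr 1 with x
  by_cases h : x ≤ r
  · rw [truncatedWeight_of_le h, ← Real.exp_nat_mul]
    simp only [Set.indicator_of_mem (Set.mem_Iic.2 h), Pi.one_apply, one_mul, ← Real.exp_add]
    congr 1
    push_cast
    ring
  · simp [truncatedWeight, h]

lemma integral_truncatedWeight_sub_one_sq {b : ℝ} (hb : 0 ≤ b) (r : ℝ) :
    ∫ x, (truncatedWeight b r x - 1) ^ 2 ∂(gaussianReal 0 1) =
      Real.exp (b ^ 2) * (1 - gaussianTail (r - 2 * b)) - 2 * (1 - gaussianTail (r - b)) + 1 := by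
  have h1 := integrable_comp_truncatedWeight hb r (f := fun y => y ^ 2) (by fun_prop)
  have h2 := integrable_comp_truncatedWeight hb r (f := fun y => 2 * y) (by fun_prop)
  have h3 : Integrable (fun x => truncatedWeight b r x ^ 2 - 2 * truncatedWeight b r x)
    (gaussianReal 0 1) := h1.sub h2
  have h4 : ∀ x, (truncatedWeight b r x - 1) ^ 2 =
      (truncatedWeight b r x ^ 2 - 2 * truncatedWeight b r x) + 1 := fun x => by ring
  simp only [h4]
  rw [integral_add h3 (integrable_const _), integral_sub h1 h2, integral_const_mul,
    integral_truncatedWeight, integral_truncatedWeight_sq]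
  simp

lemma abs_exp_sub_quadratic_le {u : ℝ} (hu : |u| ≤ 1) :
    |Real.exp u - 1 - u - u ^ 2 / 2| ≤ |u| * u ^ 2 := by
  have h := Real.exp_bound hu (n := 3) (by norm_num)
  simp only [Finset.sum_range_succ, Finset.sum_range_zero] at h
  norm_num [Nat.factorial] at h
  have h1 : |Real.exp u - 1 - u - u ^ 2 / 2| = |Real.exp u - (1 + u + u ^ 2 / 2)| := by
    congr 1
    ring
  rw [h1]
  refine h.trans ?_
  rw [pow_succ, sq_abs]
  nlinarith [mul_nonneg (abs_nonneg u) (sq_nonneg u)]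

/-- Taylor expansion under the integral; `hc` keeps the exponent in `[-1, 1]`, so the cubic
remainder is at most its supremum times the quadratic term. The linear term survives because
truncation lowers the mean below 1. -/
lemma abs_integral_exp_truncatedWeight_le {b : ℝ} (hb : 0 ≤ b) (r c : ℝ)
    (hc : |c| * (Real.exp (b * r - b ^ 2 / 2) + 1) ≤ 1) :
    |(∫ x, Real.exp (c * (truncatedWeight b r x - 1)) ∂(gaussianReal 0 1)) - 1 -
        (-(c * gaussianTail (r - b)) +
          c ^ 2 * (∫ x, (truncatedWeight b r x - 1) ^ 2 ∂(gaussianReal 0 1)) / 2)| ≤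
      |c| * (Real.exp (b * r - b ^ 2 / 2) + 1) *
        (c ^ 2 * ∫ x, (truncatedWeight b r x - 1) ^ 2 ∂(gaussianReal 0 1)) := by
  set μ := gaussianReal 0 1
  set K := Real.exp (b * r - b ^ 2 / 2) + 1
  have i1 : Integrable (fun x => Real.exp (c * (truncatedWeight b r x - 1))) μ :=
    integrable_comp_truncatedWeight hb r (f := fun y => Real.exp (c * (y - 1))) (by fun_prop)
  have i2 : Integrable (fun x => c * (truncatedWeight b r x - 1)) μ :=
    integrable_comp_truncatedWeight hb r (f := fun y => c * (y - 1)) (by fun_prop)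
  have i3 : Integrable (fun x => c ^ 2 * (truncatedWeight b r x - 1) ^ 2 / 2) μ :=
    integrable_comp_truncatedWeight hb r (f := fun y => c ^ 2 * (y - 1) ^ 2 / 2) (by fun_prop)
  have i4 : Integrable (fun x => |c| * K * (c ^ 2 * (truncatedWeight b r x - 1) ^ 2)) μ :=
    integrable_comp_truncatedWeight hb r (f := fun y => |c| * K * (c ^ 2 * (y - 1) ^ 2))
      (by fun_prop)
  have i5 : Integrable (fun x => truncatedWeight b r x) μ :=
    integrable_comp_truncatedWeight hb r (f := fun y => y) (by fun_prop)
  have i6 : Integrable (fun x => Real.exp (c * (truncatedWeight b r x - 1)) - 1) μ :=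
    i1.sub (integrable_const _)
  have i7 : Integrable (fun x => Real.exp (c * (truncatedWeight b r x - 1)) - 1 -
    c * (truncatedWeight b r x - 1)) μ := i6.sub i2
  have e : (∫ x, Real.exp (c * (truncatedWeight b r x - 1)) ∂μ) - 1 -
        (-(c * gaussianTail (r - b)) + c ^ 2 * (∫ x, (truncatedWeight b r x - 1) ^ 2 ∂μ) / 2) =
      ∫ x, (Real.exp (c * (truncatedWeight b r x - 1)) - 1 - c * (truncatedWeight b r x - 1) -
        c ^ 2 * (truncatedWeight b r x - 1) ^ 2 / 2) ∂μ := by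
    rw [integral_sub i7 i3, integral_sub i6 i2, integral_sub i1 (integrable_const _),
      integral_const_mul, integral_sub i5 (integrable_const _), integral_truncatedWeight,
      integral_div, integral_const_mul]
    simp only [integral_const, probReal_univ, smul_eq_mul, mul_one]
    ring
  rw [e, ← integral_const_mul, ← integral_const_mul, ← Real.norm_eq_abs]
  refine norm_integral_le_of_norm_le i4 (Eventually.of_forall fun x => ?_)
  have hu : |c * (truncatedWeight b r x - 1)| ≤ |c| * K := by
    rw [abs_mul]
    exact mul_le_mul_of_nonneg_left (abs_truncatedWeight_sub_one_le hb r x) (abs_nonneg c)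
  have h := abs_exp_sub_quadratic_le (hu.trans hc)
  rw [mul_pow] at h
  rw [Real.norm_eq_abs]
  exact h.trans (mul_le_mul_of_nonneg_right hu (by positivity))

/-- Squeeze between `e / (1 + e) ≤ log (1 + e) ≤ e`. -/
lemma tendsto_mul_log_one_add_div {M s e : ℕ → ℝ} {L : ℝ} (hM : ∀ᶠ n in atTop, 0 ≤ M n)
    (hs : ∀ᶠ n in atTop, 0 < s n) (he : Tendsto e atTop (𝓝 0))
    (h : Tendsto (fun n => M n * e n / s n) atTop (𝓝 L)) :
    Tendsto (fun n => M n * Real.log (1 + e n) / s n) atTop (𝓝 L) := by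
  have h1 : Tendsto (fun n => M n * e n / s n / (1 + e n)) atTop (𝓝 L) := by
    have h2 := h.div (he.const_add 1) (by norm_num)
    rw [add_zero, div_one] at h2
    exact h2
  have hpos : ∀ᶠ n in atTop, 0 < 1 + e n := by
    filter_upwards [he.eventually (lt_mem_nhds (show (-1 : ℝ) < 0 by norm_num))] with n hn
    linarith
  refine tendsto_of_tendsto_of_tendsto_of_le_of_le' h1 h ?_ ?_
  · filter_upwards [hpos, hM, hs] with n hn hMn hsn
    have h2 := Real.one_sub_inv_le_log_of_pos hn
    have h3 : 1 - (1 + e n)⁻¹ = e n / (1 + e n) := by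
      field_simp
      ring
    rw [h3] at h2
    calc M n * e n / s n / (1 + e n) = M n * (e n / (1 + e n)) / s n := by ring
      _ ≤ _ := by gcongr
  · filter_upwards [hpos, hM, hs] with n hn hMn hsn
    have h2 := Real.log_le_sub_one_of_pos hn
    gcongr
    linarith

lemma gaussianTail_le_one (r : ℝ) : gaussianTail r ≤ 1 := measureReal_le_one

/-- The logarithmic moment generating functions of sums of `M` independent truncated weights are
asymptotically quadratic. -/
lemma tendsto_mul_log_integral_exp_truncatedWeight {b r t a M : ℕ → ℝ} {v : ℝ}
    (hb : ∀ n, 0 ≤ b n) (hb' : Tendsto b atTop atTop) (hM : ∀ n, 0 < M n)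
    (ht : Tendsto t atTop atTop)
    (haM : ∀ n, a n ^ 2 / M n = Real.exp (-b n ^ 2))
    (hta : Tendsto (fun n => t n * (a n / M n)) atTop (𝓝 0))
    (htM : Tendsto (fun n => t n ^ 2 / M n) atTop (𝓝 0))
    (hcut : Tendsto (fun n => t n * (a n / M n) * Real.exp (b n * r n - b n ^ 2 / 2)) atTop (𝓝 0))
    (hmean : Tendsto (fun n => a n / t n * gaussianTail (r n - b n)) atTop (𝓝 0))
    (hvar : Tendsto (fun n => gaussianTail (r n - 2 * b n)) atTop (𝓝 (1 - v))) (l : ℝ) :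
    Tendsto (fun n => M n * Real.log (∫ x, Real.exp (l * (t n * (a n / M n)) *
      (truncatedWeight (b n) (r n) x - 1)) ∂(gaussianReal 0 1)) / t n ^ 2) atTop
      (𝓝 (v * l ^ 2 / 2)) := by
  set m : ℕ → ℝ := fun n => ∫ x, (truncatedWeight (b n) (r n) x - 1) ^ 2 ∂(gaussianReal 0 1)
    with hm
  set c : ℕ → ℝ := fun n => l * (t n * (a n / M n)) with hc
  set e : ℕ → ℝ := fun n => (∫ x, Real.exp (c n * (truncatedWeight (b n) (r n) x - 1))
    ∂(gaussianReal 0 1)) - 1 with he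
  set h : ℕ → ℝ := fun n => |c n| * (Real.exp (b n * r n - b n ^ 2 / 2) + 1) with hh
  -- `h n` bounds the exponent uniformly in `x`; its vanishing both permits the Taylor expansion and
  -- kills the cubic remainder.
  have hh0 : Tendsto h atTop (𝓝 0) := by
    have h1 := ((hcut.add hta).const_mul l).abs
    simp only [add_zero, mul_zero, abs_zero] at h1
    refine h1.congr fun n => ?_
    have hp : 0 < Real.exp (b n * r n - b n ^ 2 / 2) + 1 := by positivity
    simp only [hh, hc]
    conv_rhs => rw [← abs_of_pos hp, ← abs_mul]
    congr 1
    ring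
  have hv : Tendsto (fun n => Real.exp (-b n ^ 2) * m n) atTop (𝓝 v) := by
    have hexp : Tendsto (fun n => Real.exp (-b n ^ 2)) atTop (𝓝 0) := by
      refine Real.tendsto_exp_atBot.comp ?_
      have h1 : Tendsto (fun n => b n ^ 2) atTop atTop :=
        (tendsto_pow_atTop two_ne_zero).comp hb'
      exact (tendsto_neg_atTop_atBot.comp h1).congr fun n => by simp
    have h1 : Tendsto (fun n => Real.exp (-b n ^ 2) * (-2 * (1 - gaussianTail (r n - b n)) + 1))
        atTop (𝓝 0) := by
      refine squeeze_zero_norm (fun n => ?_) hexp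
      rw [Real.norm_eq_abs, abs_mul, abs_of_pos (Real.exp_pos _)]
      refine mul_le_of_le_one_right (Real.exp_pos _).le ?_
      have := gaussianTail_nonneg (r n - b n)
      have := gaussianTail_le_one (r n - b n)
      rw [abs_le]
      constructor <;> linarith
    have h2 := (hvar.const_sub 1).add h1
    simp only [sub_sub_cancel, add_zero] at h2
    refine h2.congr fun n => ?_
    simp only [hm]
    rw [integral_truncatedWeight_sub_one_sq (hb n)]
    have h3 : Real.exp (-b n ^ 2) * Real.exp (b n ^ 2) = 1 := by
      rw [← Real.exp_add]
      simp
    linear_combination (-(1 - gaussianTail (r n - 2 * b n))) * h3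
  have htpos := ht.eventually_gt_atTop 0
  -- Here the normalisation `a² / M = e^{-b²}` cancels the growth `e^{b²}` of the second moment.
  have hquad : ∀ᶠ n in atTop, M n * (c n ^ 2 * m n) / t n ^ 2 =
      l ^ 2 * (Real.exp (-b n ^ 2) * m n) := by
    filter_upwards [htpos] with n hn
    rw [← haM]
    simp only [hc]
    have := (hM n).ne'
    field_simp
  have hMe : Tendsto (fun n => M n * e n / t n ^ 2) atTop (𝓝 (v * l ^ 2 / 2)) := by
    have hmain : Tendsto (fun n => -l * (a n / t n * gaussianTail (r n - b n)) +
        l ^ 2 * (Real.exp (-b n ^ 2) * m n) / 2) atTop (𝓝 (v * l ^ 2 / 2)) := by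
      have h1 := (hmean.const_mul (-l)).add ((hv.const_mul (l ^ 2)).div_const 2)
      convert h1 using 2
      ring
    have hrem : Tendsto (fun n => h n * (l ^ 2 * (Real.exp (-b n ^ 2) * m n))) atTop (𝓝 0) := by
      have h1 := hh0.mul (hv.const_mul (l ^ 2))
      rwa [zero_mul] at h1
    have hdiff : Tendsto (fun n => M n * e n / t n ^ 2 -
        (-l * (a n / t n * gaussianTail (r n - b n)) +
          l ^ 2 * (Real.exp (-b n ^ 2) * m n) / 2)) atTop (𝓝 0) := by
      refine squeeze_zero_norm' ?_ hrem
      filter_upwards [htpos, hquad, hh0.eventually (ge_mem_nhds zero_lt_one)] with n hn hq hle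
      have hMt : 0 ≤ M n / t n ^ 2 := by
        have := hM n
        positivity
      have key := mul_le_mul_of_nonneg_left
        (abs_integral_exp_truncatedWeight_le (hb n) (r n) (c n) hle) hMt
      rw [← hq, Real.norm_eq_abs]
      have e1 : M n * e n / t n ^ 2 - (-l * (a n / t n * gaussianTail (r n - b n)) +
          M n * (c n ^ 2 * m n) / t n ^ 2 / 2) = M n / t n ^ 2 *
          (e n - (-(c n * gaussianTail (r n - b n)) + c n ^ 2 * m n / 2)) := by
        have := (hM n).ne'
        simp only [hc]
        field_simp
      rw [e1, abs_mul, abs_of_nonneg hMt]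
      refine key.trans (le_of_eq ?_)
      simp only [hh, hm]
      ring
    have h2 := hdiff.add hmain
    simpa using h2
  -- `e` is the convergent sequence `M e / t²` times `t² / M → 0`.
  have he0 : Tendsto e atTop (𝓝 0) := by
    have h1 := hMe.mul htM
    rw [mul_zero] at h1
    refine h1.congr' ?_
    filter_upwards [htpos] with n hn
    have := (hM n).ne'
    field_simp
  have := tendsto_mul_log_one_add_div (Eventually.of_forall fun n => (hM n).le)
    (htpos.mono fun n hn => by positivity) he0 hMe
  simpa only [he, add_sub_cancel] using this

end TruncatedWeight

namespace REM

/-! ### From truncated weights to the free energy. -/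

section Core

lemma card_spinConfig (N : ℕ) : Fintype.card (SpinConfig N) = 2 ^ N := by
  simp [SpinConfig]

lemma partitionFunction_pos {Ω : Type*} (X : (N : ℕ) → SpinConfig N → Ω → ℝ) (β : ℝ) (N : ℕ) (ω : Ω) :
    0 < partitionFunction X β N ω :=
  Finset.sum_pos (fun _ _ => Real.exp_pos _) Finset.univ_nonempty

variable {Ω : Type*} [MeasurableSpace Ω] {P : Measure Ω} {X : (N : ℕ) → SpinConfig N → Ω → ℝ}

lemma IsDisorder.integral_partitionFunction (hX : IsDisorder P X) (β : ℝ) (N : ℕ) :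
    ∫ ω, partitionFunction X β N ω ∂P = 2 ^ N * Real.exp ((β * √(N : ℝ)) ^ 2 / 2) := by
  have hmgf : ∀ σ, ∫ ω, Real.exp (β * √(N : ℝ) * X N σ ω) ∂P =
      Real.exp ((β * √(N : ℝ)) ^ 2 / 2) := fun σ => by
    have := mgf_gaussianReal (hX.law N σ) (β * √(N : ℝ))
    simpa [mgf] using this
  have hint : ∀ σ, Integrable (fun ω => Real.exp (β * √(N : ℝ) * X N σ ω)) P := fun σ => by
    -- A non-integrable function has Bochner integral 0, whereas the Gaussian value is positive.
    by_contra h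
    have h1 := hmgf σ
    rw [integral_undef h] at h1
    exact (Real.exp_pos _).ne h1
  simp only [partitionFunction]
  rw [integral_finsetSum _ fun σ _ => hint σ]
  simp only [hmgf, Finset.sum_const, Finset.card_univ, card_spinConfig, nsmul_eq_mul]
  push_cast
  rfl

lemma IsDisorder.measurable_partitionFunction (hX : IsDisorder P X) (β : ℝ) (N : ℕ) :
    Measurable (partitionFunction X β N) := by
  unfold partitionFunction
  refine Finset.measurable_sum _ fun σ _ => ?_
  have := hX.measurable N σ
  fun_prop

lemma IsDisorder.measurable_rescaledFreeEnergy (hX : IsDisorder P X) (β : ℝ) (t : ℕ → ℝ)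
    (N : ℕ) : Measurable (rescaledFreeEnergy P X β t N) := by
  unfold rescaledFreeEnergy
  exact ((Real.measurable_log.comp
    ((hX.measurable_partitionFunction β N).div_const _))).const_mul _

lemma partitionFunction_div_eq (hX : IsDisorder P X) (β : ℝ) (N : ℕ) (ω : Ω) :
    partitionFunction X β N ω / ∫ ω', partitionFunction X β N ω' ∂P =
      (∑ σ, Real.exp (β * √(N : ℝ) * X N σ ω - (β * √(N : ℝ)) ^ 2 / 2)) / 2 ^ N := by
  rw [hX.integral_partitionFunction]
  simp only [Real.exp_sub, ← Finset.sum_div, partitionFunction]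
  rw [div_div, mul_comm (2 ^ N : ℝ)]

/-- The normalized sum of the truncated Boltzmann weights. -/
def truncatedFluctuation (X : (N : ℕ) → SpinConfig N → Ω → ℝ) (β : ℝ) (t r : ℕ → ℝ) (N : ℕ)
    (ω : Ω) : ℝ :=
  ∑ σ, Real.exp ((N : ℝ) / 2 * (Real.log 2 - β ^ 2)) / (2 ^ N * t N) *
    (truncatedWeight (β * √(N : ℝ)) (r N) (X N σ ω) - 1)

lemma IsDisorder.measurable_truncatedFluctuation (hX : IsDisorder P X) (β : ℝ) (t r : ℕ → ℝ)
    (N : ℕ) : Measurable (truncatedFluctuation X β t r N) := by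
  unfold truncatedFluctuation
  refine Finset.measurable_sum _ fun σ _ => ?_
  have := hX.measurable N σ
  fun_prop

lemma IsDisorder.integrable_exp_truncatedFluctuation [IsProbabilityMeasure P] (hX : IsDisorder P X)
    {β : ℝ} (hβ : 0 ≤ β) (t r : ℕ → ℝ) (N : ℕ) (l : ℝ) :
    Integrable (fun ω => Real.exp (l * truncatedFluctuation X β t r N ω)) P := by
  set A := Real.exp ((N : ℝ) / 2 * (Real.log 2 - β ^ 2)) / (2 ^ N * t N)
  set K := Real.exp (β * √(N : ℝ) * r N - (β * √(N : ℝ)) ^ 2 / 2) + 1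
  have hbound : ∀ ω, |truncatedFluctuation X β t r N ω| ≤ ∑ _σ : SpinConfig N, |A| * K := by
    intro ω
    refine (Finset.abs_sum_le_sum_abs _ _).trans (Finset.sum_le_sum fun σ _ => ?_)
    rw [abs_mul]
    exact mul_le_mul_of_nonneg_left (abs_truncatedWeight_sub_one_le (by positivity) _ _)
      (abs_nonneg _)
  refine Integrable.of_bound (C := Real.exp (|l| * ∑ _σ : SpinConfig N, |A| * K))
    (Real.measurable_exp.comp
      ((hX.measurable_truncatedFluctuation β t r N).const_mul l)).aestronglyMeasurable
    (Eventually.of_forall fun ω => ?_)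
  rw [Real.norm_eq_abs, Real.abs_exp, Real.exp_le_exp]
  refine (le_abs_self _).trans ?_
  rw [abs_mul]
  exact mul_le_mul_of_nonneg_left (hbound ω) (abs_nonneg l)

lemma IsDisorder.mgf_truncatedFluctuation (hX : IsDisorder P X) (β : ℝ) (t r : ℕ → ℝ) (N : ℕ)
    (l : ℝ) :
    mgf (truncatedFluctuation X β t r N) P l =
      (∫ x, Real.exp (l * (Real.exp ((N : ℝ) / 2 * (Real.log 2 - β ^ 2)) / (2 ^ N * t N) *
        (truncatedWeight (β * √(N : ℝ)) (r N) x - 1))) ∂(gaussianReal 0 1)) ^ (2 ^ N) := by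
  set g : ℝ → ℝ := fun x => Real.exp ((N : ℝ) / 2 * (Real.log 2 - β ^ 2)) / (2 ^ N * t N) *
        (truncatedWeight (β * √(N : ℝ)) (r N) x - 1) with hg
  have hgm : Measurable g := by fun_prop
  have h1 : truncatedFluctuation X β t r N = ∑ σ, (g ∘ X N σ) := by
    ext ω
    simp [truncatedFluctuation, hg]
  have hind : iIndepFun (fun σ => g ∘ X N σ) P := (hX.indep N).comp (fun _ => g) fun _ => hgm
  rw [h1, hind.mgf_sum (fun σ => hgm.comp (hX.measurable N σ))]
  have h2 : ∀ σ, mgf (g ∘ X N σ) P l = ∫ x, Real.exp (l * g x) ∂(gaussianReal 0 1) := by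
    intro σ
    rw [← hX.law N σ, integral_map (hX.measurable N σ).aemeasurable]
    · rfl
    · exact (by fun_prop : Measurable fun x => Real.exp (l * g x)).aestronglyMeasurable
  simp only [h2, Finset.prod_const, Finset.card_univ, card_spinConfig]
  rfl

lemma IsDisorder.real_iUnion_lt_le (hX : IsDisorder P X) (N : ℕ) (r : ℝ) :
    P.real (⋃ σ, {ω | r < X N σ ω}) ≤ 2 ^ N * gaussianTail r := by
  refine (measureReal_iUnion_fintype_le _).trans (le_of_eq ?_)
  have h : ∀ σ, P.real {ω | r < X N σ ω} = gaussianTail r := by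
    intro σ
    rw [gaussianTail, ← hX.law N σ,
      map_measureReal_apply (hX.measurable N σ) measurableSet_Ioi]
    rfl
  simp only [h, Finset.sum_const, Finset.card_univ, card_spinConfig, nsmul_eq_mul]
  push_cast
  rfl

/-- Off the union no weight is truncated, so the left side is `(a/t)(Z/EZ - 1)`, while `Z/EZ =
e^{(t/a) W}` by definition of `W`. -/
lemma truncatedFluctuation_eq (hX : IsDisorder P X) {β : ℝ} {t r : ℕ → ℝ} {N : ℕ}
    (ht : 0 < t N) {ω : Ω} (hω : ω ∉ ⋃ σ, {ω | r N < X N σ ω}) :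
    truncatedFluctuation X β t r N ω =
      (Real.exp (t N / Real.exp ((N : ℝ) / 2 * (Real.log 2 - β ^ 2)) *
        rescaledFreeEnergy P X β t N ω) - 1) /
        (t N / Real.exp ((N : ℝ) / 2 * (Real.log 2 - β ^ 2))) := by
  set a := Real.exp ((N : ℝ) / 2 * (Real.log 2 - β ^ 2)) with ha
  have ha0 : 0 < a := Real.exp_pos _
  have hpos : 0 < partitionFunction X β N ω / ∫ ω', partitionFunction X β N ω' ∂P := by
    refine div_pos (partitionFunction_pos X β N ω) ?_
    rw [hX.integral_partitionFunction]
    positivity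
  have h1 : t N / a * rescaledFreeEnergy P X β t N ω =
      Real.log (partitionFunction X β N ω / ∫ ω', partitionFunction X β N ω' ∂P) := by
    rw [rescaledFreeEnergy, ← ha]
    field_simp
  rw [h1, Real.exp_log hpos, partitionFunction_div_eq hX, truncatedFluctuation, ← ha]
  have h2 : ∀ σ, truncatedWeight (β * √(N : ℝ)) (r N) (X N σ ω) =
      Real.exp (β * √(N : ℝ) * X N σ ω - (β * √(N : ℝ)) ^ 2 / 2) := by
    intro σ
    refine truncatedWeight_of_le (not_lt.1 fun h => hω ?_)
    exact Set.mem_iUnion.2 ⟨σ, h⟩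
  simp only [h2]
  rw [← Finset.mul_sum, Finset.sum_sub_distrib]
  simp only [Finset.sum_const, Finset.card_univ, card_spinConfig, nsmul_eq_mul]
  push_cast
  generalize ∑ σ, Real.exp (β * √(N : ℝ) * X N σ ω - (β * √(N : ℝ)) ^ 2 / 2) = S
  field_simp

/-- A difference quotient of `y ↦ e^{yx}` at 0. -/
lemma tendsto_exp_mul_sub_one_div {h : ℕ → ℝ} (hh : Tendsto h atTop (𝓝 0))
    (hne : ∀ᶠ n in atTop, h n ≠ 0) (x : ℝ) :
    Tendsto (fun n => (Real.exp (h n * x) - 1) / h n) atTop (𝓝 x) := by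
  have hd : HasDerivAt (fun y : ℝ => Real.exp (y * x)) x 0 := by
    have := ((hasDerivAt_id (0 : ℝ)).mul_const x).exp
    simpa using this
  have h1 := hasDerivAt_iff_tendsto_slope.1 hd
  have h2 := h1.comp (tendsto_nhdsWithin_iff.2 ⟨hh, hne⟩)
  refine h2.congr fun n => ?_
  simp [slope_def_field]

lemma tendsto_mul_exp_neg_mul {t : ℕ → ℝ} (ht : t =o[atTop] (fun N : ℕ => √(N : ℝ))) {c : ℝ}
    (hc : 0 < c) : Tendsto (fun N : ℕ => t N * Real.exp (-(c * N))) atTop (𝓝 0) := by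
  have h1 : Tendsto (fun N : ℕ => (N : ℝ) * Real.exp (-(c * N))) atTop (𝓝 0) := by
    have := (tendsto_rpow_mul_exp_neg_mul_atTop_nhds_zero 1 c hc).comp
      tendsto_natCast_atTop_atTop
    simpa [Function.comp_def] using this
  refine squeeze_zero_norm' ?_ h1
  filter_upwards [ht.bound zero_lt_one, eventually_ge_atTop 1] with N hN hN1
  rw [norm_mul, Real.norm_eq_abs (Real.exp _), Real.abs_exp]
  refine mul_le_mul_of_nonneg_right (hN.trans ?_) (Real.exp_pos _).le
  have h2 : (1 : ℝ) ≤ N := by exact_mod_cast hN1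
  rw [one_mul, Real.norm_of_nonneg (Real.sqrt_nonneg _), Real.sqrt_le_left (by linarith)]
  nlinarith

lemma two_pow_eq_exp (N : ℕ) : (2 : ℝ) ^ N = Real.exp (N * Real.log 2) := by
  rw [Real.exp_nat_mul, Real.exp_log two_pos]

/-- The large deviation principle for the free energy, given truncation levels `r` for the
disorder. The variance `v` of the limit is the asymptotic proportion of the second moment that
comes from disorder below the level. -/
theorem IsDisorder.satisfiesLDP_of_truncation [IsProbabilityMeasure P] (hX : IsDisorder P X)
    {β : ℝ} (hβ : 0 < β) (hβ2 : β ^ 2 < Real.log 2) {t r : ℕ → ℝ} {v : ℝ} (hv : 0 < v)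
    (ht : Tendsto t atTop atTop) (hto : t =o[atTop] (fun N : ℕ => √(N : ℝ)))
    (hcut : Tendsto (fun N : ℕ => t N * Real.exp (β * √(N : ℝ) * r N -
      (N : ℝ) * (Real.log 2 / 2 + β ^ 2))) atTop (𝓝 0))
    (hbad : ∀ c : ℝ, ∀ᶠ N : ℕ in atTop,
      2 ^ N * gaussianTail (r N) ≤ Real.exp (-(c * t N ^ 2)))
    (hmean : Tendsto (fun N : ℕ => Real.exp ((N : ℝ) / 2 * (Real.log 2 - β ^ 2)) *
      gaussianTail (r N - β * √(N : ℝ))) atTop (𝓝 0))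
    (hvar : Tendsto (fun N : ℕ => gaussianTail (r N - 2 * (β * √(N : ℝ)))) atTop (𝓝 (1 - v))) :
    SatisfiesLDP P (rescaledFreeEnergy P X β t) (fun N => t N ^ 2)
      (fun x : ℝ => ENNReal.ofReal (x ^ 2 / (2 * v))) := by
  have hsq : ∀ N : ℕ, (β * √(N : ℝ)) ^ 2 = N * β ^ 2 := fun N => by
    rw [mul_pow, Real.sq_sqrt (Nat.cast_nonneg N), mul_comm]
  have haM : ∀ N : ℕ, Real.exp ((N : ℝ) / 2 * (Real.log 2 - β ^ 2)) / 2 ^ N =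
      Real.exp (-((Real.log 2 + β ^ 2) / 2 * N)) := fun N => by
    rw [two_pow_eq_exp, ← Real.exp_sub]
    congr 1
    ring
  have hlog2 : 0 < Real.log 2 := Real.log_pos one_lt_two
  have htpos := ht.eventually_gt_atTop 0
  refine satisfiesLDP_of_mgf hv (hX.measurable_truncatedFluctuation β t r)
    (hX.measurable_rescaledFreeEnergy β t) ((tendsto_pow_atTop two_ne_zero).comp ht)
    (hX.integrable_exp_truncatedFluctuation hβ.le t r) ?_
    (fun N => ⋃ σ, {ω | r N < X N σ ω}) ?_
    (fun N x => (Real.exp (t N / Real.exp ((N : ℝ) / 2 * (Real.log 2 - β ^ 2)) * x) - 1) /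
        (t N / Real.exp ((N : ℝ) / 2 * (Real.log 2 - β ^ 2)))) ?_ ?_
  · intro l
    have key := tendsto_mul_log_integral_exp_truncatedWeight
      (b := fun N : ℕ => β * √(N : ℝ)) (r := r) (t := t)
      (a := fun N : ℕ => Real.exp ((N : ℝ) / 2 * (Real.log 2 - β ^ 2)))
      (M := fun N : ℕ => 2 ^ N) (v := v) (fun N => by positivity)
      ((Real.tendsto_sqrt_atTop.comp tendsto_natCast_atTop_atTop).const_mul_atTop hβ)
      (fun N => by positivity) ht ?_ ?_ ?_ ?_ ?_ hvar l
    -- Independence makes the moment generating function a `2^N`-th power, whose logarithm gives the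
    -- factor `M`; one `t` of the argument `l t²` cancels against the normalisation.
    · refine key.congr' ?_
      filter_upwards [htpos] with N hN
      rw [hX.mgf_truncatedFluctuation, Real.log_pow]
      push_cast
      congr 3
      refine integral_congr_ae (Eventually.of_forall fun x => ?_)
      simp only
      congr 1
      field_simp
    · intro N
      rw [hsq, two_pow_eq_exp, ← Real.exp_nat_mul, ← Real.exp_sub]
      congr 1
      push_cast
      ring
    · simp only [haM]
      exact tendsto_mul_exp_neg_mul hto (by positivity)
    · have h1 := (tendsto_mul_exp_neg_mul hto (c := Real.log 2 / 2) (by positivity)).pow 2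
      rw [zero_pow two_ne_zero] at h1
      refine h1.congr fun N => ?_
      rw [mul_pow, ← Real.exp_nat_mul, two_pow_eq_exp, div_eq_mul_inv (t N ^ 2), ← Real.exp_neg]
      congr 2
      push_cast
      ring
    · refine hcut.congr fun N => ?_
      rw [haM, mul_assoc (t N), ← Real.exp_add, hsq]
      congr 2
      ring
    · have h1 := hmean.mul (tendsto_inv_atTop_zero.comp ht)
      rw [zero_mul] at h1
      refine h1.congr fun N => ?_
      simp only [Function.comp]
      ring
  · intro c
    filter_upwards [hbad c] with N hN
    exact (hX.real_iUnion_lt_le N (r N)).trans hN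
  · intro x
    refine tendsto_exp_mul_sub_one_div ?_ ?_ x
    · refine (tendsto_mul_exp_neg_mul hto (c := (Real.log 2 - β ^ 2) / 2)
        (by linarith)).congr fun N => ?_
      rw [div_eq_mul_inv (t N), ← Real.exp_neg]
      congr 2
      ring
    · filter_upwards [htpos] with N hN
      positivity
  · filter_upwards [htpos] with N hN
    refine ⟨fun x y hxy => ?_, fun ω hω => truncatedFluctuation_eq hX hN hω⟩
    have h0 : 0 < t N / Real.exp ((N : ℝ) / 2 * (Real.log 2 - β ^ 2)) := by positivity
    simp only
    gcongr

end Core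

end REM

namespace REM

/-! ### The regime `β < √(log 2 / 2)`: truncation at `q√N`. -/

section HighTemperature

variable {Ω : Type*} [MeasurableSpace Ω] {P : Measure Ω} [IsProbabilityMeasure P]
  {X : (N : ℕ) → SpinConfig N → Ω → ℝ}

lemma tendsto_sqrt_natCast_atTop : Tendsto (fun N : ℕ => √(N : ℝ)) atTop atTop :=
  Real.tendsto_sqrt_atTop.comp tendsto_natCast_atTop_atTop

lemma eventually_gaussianTail_mul_sqrt_le {q : ℝ} (hq : 0 < q) :
    ∀ᶠ N : ℕ in atTop, gaussianTail (q * √(N : ℝ)) ≤ Real.exp (-(q ^ 2 / 2 * N)) := by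
  filter_upwards [(tendsto_sqrt_natCast_atTop.const_mul_atTop hq).eventually_ge_atTop 1] with N hN
  refine (gaussianTail_le (by linarith)).trans ((div_le_self (Real.exp_pos _).le hN).trans ?_)
  rw [mul_pow, Real.sq_sqrt (Nat.cast_nonneg N)]
  exact Real.exp_le_exp.2 (by linarith)

/-- The four conditions say in turn that the second moment is retained, that the scaled weights stay
small, that no variable exceeds the level, and that the loss of mean is negligible. With `T = √(log
2 / 2)`, any `q` strictly between `2T` and `(T² + β²)/β` works, and this interval is nonempty
because `(T - β)² > 0`. -/
lemma exists_truncation_slope {β : ℝ} (hβ : 0 < β) (hβ2 : β < √(Real.log 2 / 2)) :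
    ∃ q, 2 * β < q ∧ β * q < Real.log 2 / 2 + β ^ 2 ∧ 2 * Real.log 2 < q ^ 2 ∧
      Real.log 2 - β ^ 2 < (q - β) ^ 2 := by
  have hlog2 : 0 < Real.log 2 := Real.log_pos one_lt_two
  set T := √(Real.log 2 / 2) with hT
  have hT2 : Real.log 2 = 2 * T ^ 2 := by
    rw [hT, Real.sq_sqrt (by positivity)]
    ring
  have hTpos : 0 < T := hβ.trans hβ2
  have h1 : 2 * T < (T ^ 2 + β ^ 2) / β := by
    rw [lt_div_iff₀ hβ]
    nlinarith [sq_pos_of_pos (sub_pos.2 hβ2)]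
  obtain ⟨q, hq1, hq2⟩ := exists_between h1
  rw [lt_div_iff₀ hβ] at hq2
  rw [hT2]
  refine ⟨q, by linarith, by linarith, by nlinarith, ?_⟩
  nlinarith [sq_nonneg (T - β), mul_pos (sub_pos.2 hq1) (show 0 < q + 2 * T - 2 * β by linarith)]

lemma eventually_mul_sq_le_mul {t u : ℕ → ℝ} (hu : ∀ᶠ n in atTop, 0 ≤ u n)
    (h : t =o[atTop] (fun n => √(u n))) (c : ℝ) {d : ℝ} (hd : 0 < d) :
    ∀ᶠ n in atTop, c * t n ^ 2 ≤ d * u n := by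
  have h1 : 0 < √(d / (|c| + 1)) := Real.sqrt_pos.2 (by positivity)
  filter_upwards [h.bound h1, hu] with n hn hun
  have h2 : t n ^ 2 ≤ d / (|c| + 1) * u n := by
    have h3 := pow_le_pow_left₀ (norm_nonneg _) hn 2
    rwa [Real.norm_eq_abs, sq_abs, mul_pow, Real.sq_sqrt (by positivity), Real.norm_eq_abs, sq_abs,
      Real.sq_sqrt hun] at h3
  calc c * t n ^ 2 ≤ (|c| + 1) * t n ^ 2 :=
        mul_le_mul_of_nonneg_right (by linarith [le_abs_self c]) (sq_nonneg _)
    _ ≤ (|c| + 1) * (d / (|c| + 1) * u n) := by gcongr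
    _ = d * u n := by field_simp

lemma tendsto_exp_neg_mul_natCast {d : ℝ} (hd : 0 < d) :
    Tendsto (fun N : ℕ => Real.exp (-(d * N))) atTop (𝓝 0) :=
  Real.tendsto_exp_atBot.comp (tendsto_neg_atTop_atBot.comp
    (tendsto_natCast_atTop_atTop.const_mul_atTop hd))

/-- Moderate deviations of the free energy for `β < √(log 2 / 2)`. -/
theorem IsDisorder.satisfiesLDP_of_lt (hX : IsDisorder P X) {β : ℝ} (hβ : 0 < β)
    (hβ2 : β < √(Real.log 2 / 2)) {t : ℕ → ℝ} (ht : Tendsto t atTop atTop)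
    (hto : t =o[atTop] (fun N : ℕ => √(N : ℝ))) :
    SatisfiesLDP P (rescaledFreeEnergy P X β t) (fun N => t N ^ 2)
      (fun x : ℝ => ENNReal.ofReal (x ^ 2 / 2)) := by
  have hlog2 : 0 < Real.log 2 := Real.log_pos one_lt_two
  obtain ⟨q, hq1, hq2, hq3, hq4⟩ := exists_truncation_slope hβ hβ2
  have hsq : β ^ 2 < Real.log 2 := by
    have := (Real.lt_sqrt hβ.le).1 hβ2
    linarith
  have key := hX.satisfiesLDP_of_truncation hβ hsq (r := fun N => q * √(N : ℝ)) (v := 1) one_pos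
    ht hto ?_ ?_ ?_ ?_
  · simpa using key
  · refine (tendsto_mul_exp_neg_mul hto (c := Real.log 2 / 2 + β ^ 2 - β * q)
      (by linarith)).congr fun N => ?_
    have h1 : β * √(N : ℝ) * (q * √(N : ℝ)) = β * q * N := by
      rw [mul_mul_mul_comm, Real.mul_self_sqrt (Nat.cast_nonneg N)]
    rw [h1]
    congr 2
    ring
  · intro c
    filter_upwards [eventually_gaussianTail_mul_sqrt_le (show 0 < q by linarith),
      eventually_mul_sq_le_mul (u := fun N : ℕ => (N : ℝ))
        (Eventually.of_forall fun N => Nat.cast_nonneg N) hto c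
        (show 0 < q ^ 2 / 2 - Real.log 2 by linarith)] with N h1 h2
    calc (2 : ℝ) ^ N * gaussianTail (q * √(N : ℝ)) ≤
          Real.exp (N * Real.log 2) * Real.exp (-(q ^ 2 / 2 * N)) := by
          rw [two_pow_eq_exp]
          gcongr
      _ = Real.exp (-((q ^ 2 / 2 - Real.log 2) * N)) := by
          rw [← Real.exp_add]
          congr 1
          ring
      _ ≤ _ := Real.exp_le_exp.2 (by linarith)
  · refine squeeze_zero' (Eventually.of_forall fun N => mul_nonneg (Real.exp_pos _).le
      (gaussianTail_nonneg _)) ?_ (tendsto_exp_neg_mul_natCast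
        (show 0 < ((q - β) ^ 2 - (Real.log 2 - β ^ 2)) / 2 by linarith))
    filter_upwards [eventually_gaussianTail_mul_sqrt_le (show 0 < q - β by linarith)] with N hN
    rw [← sub_mul]
    refine (mul_le_mul_of_nonneg_left hN (Real.exp_pos _).le).trans (le_of_eq ?_)
    rw [← Real.exp_add]
    congr 1
    ring
  · rw [sub_self]
    refine tendsto_gaussianTail_atTop ((tendsto_sqrt_natCast_atTop.const_mul_atTop
      (show 0 < q - 2 * β by linarith)).congr fun N => ?_)
    ring

end HighTemperature

/-! ### The critical case `β = √(log 2 / 2)`: truncation just below `2β√N`. -/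

section Critical

variable {Ω : Type*} [MeasurableSpace Ω] {P : Measure Ω} [IsProbabilityMeasure P]
  {X : (N : ℕ) → SpinConfig N → Ω → ℝ}

lemma tendsto_log_natCast_atTop : Tendsto (fun N : ℕ => Real.log (N : ℝ)) atTop atTop :=
  Real.tendsto_log_atTop.comp tendsto_natCast_atTop_atTop

lemma tendsto_log_natCast_div_sqrt : Tendsto (fun N : ℕ => Real.log (N : ℝ) / √(N : ℝ)) atTop
    (𝓝 0) := by
  have h := (isLittleO_log_rpow_atTop (show (0 : ℝ) < 1 / 2 by norm_num)).tendsto_div_nhds_zero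
  refine (h.comp tendsto_natCast_atTop_atTop).congr fun N => ?_
  simp [Real.sqrt_eq_rpow]

lemma sqrt_natCast_eq_exp {N : ℕ} (hN : 1 ≤ N) :
    √(N : ℝ) = Real.exp (Real.log (N : ℝ) / 2) := by
  have h : (0 : ℝ) < N := by exact_mod_cast hN
  rw [Real.exp_half, Real.exp_log h]

/-- Moderate deviations of the free energy at the inverse temperature where the variance of the
truncated partition function is halved, `β = √(log 2 / 2)`. -/
theorem IsDisorder.satisfiesLDP_of_eq (hX : IsDisorder P X) {β : ℝ} (hβ : 0 < β)
    (hβ2 : β = √(Real.log 2 / 2)) {t : ℕ → ℝ} (ht : Tendsto t atTop atTop)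
    (hto : t =o[atTop] (fun N : ℕ => √(Real.log (N : ℝ)))) :
    SatisfiesLDP P (rescaledFreeEnergy P X β t) (fun N => t N ^ 2)
      (fun x : ℝ => ENNReal.ofReal (x ^ 2)) := by
  have hlog2 : 0 < Real.log 2 := Real.log_pos one_lt_two
  have hL : Real.log 2 = 2 * β ^ 2 := by
    rw [hβ2, Real.sq_sqrt (by positivity)]
    ring
  have hsq : β ^ 2 < Real.log 2 := by nlinarith
  have hto' : t =o[atTop] (fun N : ℕ => √(N : ℝ)) := by
    refine hto.trans_isBigO (IsBigO.of_bound 1 (Eventually.of_forall fun N => ?_))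
    rw [one_mul, Real.norm_of_nonneg (Real.sqrt_nonneg _), Real.norm_of_nonneg (Real.sqrt_nonneg _)]
    exact Real.sqrt_le_sqrt (Real.log_le_self (Nat.cast_nonneg N))
  -- Chosen so that `b w = (log N)/8`: the scaled weights then gain a factor `N^{-1/8}`, yet `w →
  -- 0`, so the level stays asymptotically at the centre of the law tilted to `2b`.
  set w : ℕ → ℝ := fun N => Real.log (N : ℝ) / (8 * β * √(N : ℝ)) with hw
  have hw0 : Tendsto w atTop (𝓝 0) := by
    have h := tendsto_log_natCast_div_sqrt.const_mul (8 * β)⁻¹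
    rw [mul_zero] at h
    refine h.congr fun N => ?_
    simp only [hw]
    rw [inv_mul_eq_div, div_div, mul_comm]
  have hwmul : ∀ N : ℕ, 1 ≤ N → β * √(N : ℝ) * w N = Real.log (N : ℝ) / 8 := fun N hN => by
    have h : (0 : ℝ) < √(N : ℝ) := Real.sqrt_pos.2 (by exact_mod_cast hN)
    simp only [hw]
    field_simp
  have hNsq : ∀ N : ℕ, (β * √(N : ℝ)) ^ 2 = β ^ 2 * N := fun N => by
    rw [mul_pow, Real.sq_sqrt (Nat.cast_nonneg N)]
  have hwle : ∀ᶠ N : ℕ in atTop, w N ≤ β / 2 * √(N : ℝ) := by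
    filter_upwards [hw0.eventually (ge_mem_nhds zero_lt_one),
      (tendsto_sqrt_natCast_atTop.const_mul_atTop
        (show 0 < β / 2 by positivity)).eventually_ge_atTop 1] with N h1 h2
    linarith
  have hlogabs : ∀ᶠ N : ℕ in atTop, 0 ≤ Real.log (N : ℝ) :=
    tendsto_log_natCast_atTop.eventually_ge_atTop 0
  have key := hX.satisfiesLDP_of_truncation hβ hsq (r := fun N => 2 * (β * √(N : ℝ)) - w N)
    (v := 1 / 2) (by norm_num) ht hto' ?_ ?_ ?_ ?_
  · simpa using key
  · have h1 : Tendsto (fun N : ℕ => Real.log (N : ℝ) * Real.exp (-(1 / 8) * Real.log (N : ℝ))) atTop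
        (𝓝 0) := by
      have := (tendsto_rpow_mul_exp_neg_mul_atTop_nhds_zero 1 (1 / 8) (by norm_num)).comp
        tendsto_log_natCast_atTop
      simpa [Function.comp_def] using this
    refine squeeze_zero_norm' ?_ h1
    filter_upwards [hto.bound zero_lt_one, tendsto_log_natCast_atTop.eventually_ge_atTop 1,
      eventually_ge_atTop 1] with N h2 h3 h4
    have h5 : β * √(N : ℝ) * (2 * (β * √(N : ℝ)) - w N) - N * (Real.log 2 / 2 + β ^ 2) =
        -(1 / 8) * Real.log (N : ℝ) := by
      linear_combination 2 * hNsq N - hwmul N h4 - (N : ℝ) / 2 * hL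
    rw [h5, norm_mul, Real.norm_eq_abs (Real.exp _), Real.abs_exp]
    refine mul_le_mul_of_nonneg_right (h2.trans ?_) (Real.exp_pos _).le
    rw [one_mul, Real.norm_of_nonneg (Real.sqrt_nonneg _), Real.sqrt_le_left (by linarith)]
    nlinarith
  · intro c
    -- Lowering the level by `w` costs `N^{1/4}` in the union bound, while Mills' factor gains
    -- `N^{-1/2}`. The remaining `N^{-1/4} / β` beats every `e^{-c t²}` because `t² = o(log N)`;
    -- half of the exponent absorbs the constant `1 / β`.
    filter_upwards [hwle, eventually_ge_atTop 1,
      eventually_mul_sq_le_mul hlogabs hto c (show (0 : ℝ) < 1 / 8 by norm_num),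
      tendsto_log_natCast_atTop.eventually_ge_atTop (8 * -Real.log β)] with N h1 h2 h3 h4
    have hs : 0 < √(N : ℝ) := Real.sqrt_pos.2 (by exact_mod_cast h2)
    have hr : β * √(N : ℝ) ≤ 2 * (β * √(N : ℝ)) - w N := by nlinarith [mul_pos hβ hs]
    have hr0 : 0 < β * √(N : ℝ) := mul_pos hβ hs
    have h5 : -(2 * (β * √(N : ℝ)) - w N) ^ 2 / 2 ≤
        -(N * Real.log 2) + Real.log (N : ℝ) / 4 := by
      linear_combination -2 * hNsq N + 2 * hwmul N h2 + (N : ℝ) * hL + sq_nonneg (w N) / 2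
    have h6 : β * √(N : ℝ) = Real.exp (Real.log β + Real.log (N : ℝ) / 2) := by
      rw [Real.exp_add, Real.exp_log hβ, sqrt_natCast_eq_exp h2]
    calc (2 : ℝ) ^ N * gaussianTail (2 * (β * √(N : ℝ)) - w N)
        ≤ Real.exp (N * Real.log 2) * (Real.exp (-(N * Real.log 2) + Real.log (N : ℝ) / 4) /
          Real.exp (Real.log β + Real.log (N : ℝ) / 2)) := by
          rw [two_pow_eq_exp, ← h6]
          refine mul_le_mul_of_nonneg_left ((gaussianTail_le (hr0.trans_le hr)).trans ?_)
            (Real.exp_pos _).le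
          gcongr
      _ = Real.exp (-Real.log β - Real.log (N : ℝ) / 4) := by
          rw [← Real.exp_sub, ← Real.exp_add]
          congr 1
          ring
      _ ≤ Real.exp (-(c * t N ^ 2)) := Real.exp_le_exp.2 (by linarith)
  · have h1 : Tendsto (fun N : ℕ => Real.exp (-Real.log (β / 2) - 3 / 8 * Real.log (N : ℝ))) atTop
        (𝓝 0) := by
      refine Real.tendsto_exp_atBot.comp ?_
      exact tendsto_atBot_add_const_left _ _ (tendsto_neg_atTop_atBot.comp
        (tendsto_log_natCast_atTop.const_mul_atTop (by norm_num)))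
    refine squeeze_zero' (Eventually.of_forall fun N => mul_nonneg (Real.exp_pos _).le
      (gaussianTail_nonneg _)) ?_ h1
    filter_upwards [hwle, eventually_ge_atTop 1] with N h1 h2
    have hs : 0 < √(N : ℝ) := Real.sqrt_pos.2 (by exact_mod_cast h2)
    have hr : β / 2 * √(N : ℝ) ≤ 2 * (β * √(N : ℝ)) - w N - β * √(N : ℝ) := by linarith
    have hr0 : 0 < β / 2 * √(N : ℝ) := by positivity
    -- The same balance for the mean: a cost of `N^{1/8}` against Mills' `N^{-1/2}` leaves
    -- `N^{-3/8}`.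
    have h5 : -(2 * (β * √(N : ℝ)) - w N - β * √(N : ℝ)) ^ 2 / 2 ≤
        -(N / 2 * (Real.log 2 - β ^ 2)) + Real.log (N : ℝ) / 8 := by
      linear_combination -(1 / 2) * hNsq N + hwmul N h2 + (N : ℝ) / 2 * hL + sq_nonneg (w N) / 2
    have h6 : β / 2 * √(N : ℝ) = Real.exp (Real.log (β / 2) + Real.log (N : ℝ) / 2) := by
      rw [Real.exp_add, Real.exp_log (by positivity), sqrt_natCast_eq_exp h2]
    calc Real.exp ((N : ℝ) / 2 * (Real.log 2 - β ^ 2)) *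
          gaussianTail (2 * (β * √(N : ℝ)) - w N - β * √(N : ℝ))
        ≤ Real.exp ((N : ℝ) / 2 * (Real.log 2 - β ^ 2)) *
          (Real.exp (-(N / 2 * (Real.log 2 - β ^ 2)) + Real.log (N : ℝ) / 8) /
          Real.exp (Real.log (β / 2) + Real.log (N : ℝ) / 2)) := by
          rw [← h6]
          refine mul_le_mul_of_nonneg_left ((gaussianTail_le (hr0.trans_le hr)).trans ?_)
            (Real.exp_pos _).le
          gcongr
      _ = _ := by
          rw [← Real.exp_sub, ← Real.exp_add]
          congr 1
          ring
  · have h0 : Tendsto (fun N => -w N) atTop (𝓝 0) := by simpa using hw0.neg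
    have h1 := tendsto_gaussianTail_zero h0
    norm_num
    refine h1.congr fun N => ?_
    ring_nf

end Critical

/-! ### Scales of order at least `√N`, by comparison with a smaller scale. -/

section Degenerate

lemma abs_rescaledFreeEnergy_le {Ω : Type*} [MeasurableSpace Ω] {P : Measure Ω}
    {X : (N : ℕ) → SpinConfig N → Ω → ℝ} {β : ℝ} {s t : ℕ → ℝ} {N : ℕ} (hs : 0 < s N)
    (hst : s N ≤ t N) (ω : Ω) :
    |rescaledFreeEnergy P X β t N ω| ≤ |rescaledFreeEnergy P X β s N ω| := by
  unfold rescaledFreeEnergy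
  rw [abs_mul, abs_mul, abs_of_nonneg (div_nonneg (Real.exp_pos _).le (hs.le.trans hst)),
    abs_of_nonneg (div_nonneg (Real.exp_pos _).le hs.le)]
  gcongr

variable {Ω : Type*} [MeasurableSpace Ω] {P : Measure Ω} [IsProbabilityMeasure P]
  {X : (N : ℕ) → SpinConfig N → Ω → ℝ}

/-- Recovers a usable exponential bound from the abstract principle; the set `{y | x ≤ |y|}` is
closed, so its closure adds nothing. -/
lemma eventually_abs_tail_le_of_satisfiesLDP {Y : ℕ → Ω → ℝ} {s : ℕ → ℝ}
    (h : SatisfiesLDP P Y s (fun x : ℝ => ENNReal.ofReal (x ^ 2 / 2))) {x c : ℝ} (hx : 0 < x)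
    (hc : c < x ^ 2 / 2) :
    ∀ᶠ n in atTop, P.real {ω | x ≤ |Y n ω|} ≤ Real.exp (-(c * s n)) := by
  have hA : IsClosed {y : ℝ | x ≤ |y|} := isClosed_le continuous_const continuous_abs
  have h1 := h.upper_bound _ hA.measurableSet
  have h2 : ((x ^ 2 / 2 : ℝ) : EReal) ≤
      ⨅ y ∈ closure {y : ℝ | x ≤ |y|}, ((ENNReal.ofReal (y ^ 2 / 2) : ℝ≥0∞) : EReal) := by
    refine le_iInf₂ fun y hy => ?_
    rw [hA.closure_eq] at hy
    have hy : x ≤ |y| := hy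
    rw [coe_ennreal_ofReal_of_nonneg (by positivity), EReal.coe_le_coe_iff, ← sq_abs y]
    gcongr
  have h3 : limsup (fun n => (((s n)⁻¹ : ℝ) : EReal) *
      ENNReal.log (P (Y n ⁻¹' {y : ℝ | x ≤ |y|}))) atTop < ((-c : ℝ) : EReal) := by
    refine (h1.trans (EReal.neg_le_neg_iff.2 h2)).trans_lt ?_
    rw [← EReal.coe_neg, EReal.coe_lt_coe_iff]
    linarith
  filter_upwards [eventually_lt_of_limsup_lt h3, h.tendsto_speed.eventually_gt_atTop 0]
    with n hn hs
  by_contra hlt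
  exact absurd hn (not_lt.2 (le_inv_mul_log_of_le_real hs (not_le.1 hlt).le))

/-- Degenerate large deviations of the free energy on scales of order at least `√N`. -/
theorem IsDisorder.satisfiesLDP_degenerateRate (hX : IsDisorder P X) {β : ℝ} (hβ : 0 < β)
    (hβ2 : β < √(Real.log 2 / 2)) {t : ℕ → ℝ}
    (hlim : 0 < liminf (fun N : ℕ => ((t N / √(N : ℝ) : ℝ) : EReal)) atTop) {γ : ℕ → ℝ}
    (hγ : Tendsto γ atTop atTop) (hγo : γ =o[atTop] (fun N : ℕ => (N : ℝ))) :
    SatisfiesLDP P (rescaledFreeEnergy P X β t) γ degenerateRate := by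
  obtain ⟨d, hd0, hd⟩ := EReal.lt_iff_exists_real_btwn.1 hlim
  have hd0 : 0 < d := by exact_mod_cast hd0
  have hγN : ∀ d > 0, ∀ᶠ N : ℕ in atTop, γ N ≤ d * N := fun d hd => by
    filter_upwards [hγo.bound hd] with N hN
    rw [Real.norm_of_nonneg (Nat.cast_nonneg N)] at hN
    exact (le_abs_self _).trans hN
  -- `s²` is the geometric mean of `γ` and `N`, so `γ ≪ s² ≪ N`: the moderate deviation principle
  -- holds on the scale `s`, its speed outruns `γ`, and `s ≤ t` eventually. Enlarging the scale only
  -- shrinks the variable.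
  set s : ℕ → ℝ := fun N => √√(γ N * N) with hs
  have hst : Tendsto s atTop atTop :=
    Real.tendsto_sqrt_atTop.comp (Real.tendsto_sqrt_atTop.comp
      (hγ.atTop_mul_atTop₀ tendsto_natCast_atTop_atTop))
  have hso : s =o[atTop] (fun N : ℕ => √(N : ℝ)) := by
    refine isLittleO_iff.2 fun ε hε => ?_
    filter_upwards [hγN (ε ^ 4) (by positivity)] with N hN
    rw [Real.norm_of_nonneg (Real.sqrt_nonneg _), Real.norm_of_nonneg (Real.sqrt_nonneg _)]
    refine Real.sqrt_le_iff.2 ⟨by positivity, Real.sqrt_le_iff.2 ⟨by positivity, ?_⟩⟩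
    rw [mul_pow, Real.sq_sqrt (Nat.cast_nonneg N)]
    calc γ N * N ≤ ε ^ 4 * N * N := by gcongr
      _ = (ε ^ 2 * N) ^ 2 := by ring
  have hLDP := hX.satisfiesLDP_of_lt hβ hβ2 hst hso
  refine _root_.satisfiesLDP_degenerateRate (hX.measurable_rescaledFreeEnergy β t) hγ
    fun x hx c => ?_
  set k := x ^ 2 / 4 with hk
  have hk0 : 0 < k := by positivity
  filter_upwards [eventually_abs_tail_le_of_satisfiesLDP hLDP hx
      (show k < x ^ 2 / 2 by rw [hk]; linarith [sq_pos_of_pos hx]),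
    -- This constant gives `c² γ² ≤ k² γ N`, hence `c γ ≤ k s²`.
    hγN (k ^ 2 / (c ^ 2 + 1)) (by positivity), eventually_lt_of_lt_liminf hd,
    hso.bound hd0, hst.eventually_gt_atTop 0, eventually_ge_atTop 1, hγ.eventually_gt_atTop 0]
    with N h1 h2 h3 h4 h5 h6 h7
  have hN : (0 : ℝ) < N := by exact_mod_cast h6
  have hle : s N ≤ t N := by
    rw [EReal.coe_lt_coe_iff, lt_div_iff₀ (Real.sqrt_pos.2 hN)] at h3
    rw [Real.norm_of_nonneg h5.le, Real.norm_of_nonneg (Real.sqrt_nonneg _)] at h4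
    linarith
  have hsub : {ω | x ≤ |rescaledFreeEnergy P X β t N ω|} ⊆
      {ω | x ≤ |rescaledFreeEnergy P X β s N ω|} :=
    fun ω hω => le_trans hω (abs_rescaledFreeEnergy_le h5 hle ω)
  refine (measureReal_mono hsub).trans (h1.trans (Real.exp_le_exp.2 (neg_le_neg ?_)))
  have hs2 : s N ^ 2 = √(γ N * N) := Real.sq_sqrt (Real.sqrt_nonneg _)
  rw [hs2, ← div_le_iff₀' hk0]
  refine Real.le_sqrt_of_sq_le ?_
  rw [div_pow, div_le_iff₀ (by positivity)]
  rw [div_mul_eq_mul_div, le_div_iff₀ (by positivity)] at h2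
  nlinarith [mul_le_mul_of_nonneg_left h2 h7.le, sq_nonneg (γ N)]

end Degenerate

end REM

end

theorem theorem4 {Ω : Type*} [MeasurableSpace Ω] (P : Measure Ω) [IsProbabilityMeasure P]
    (X : (N : ℕ) → SpinConfig N → Ω → ℝ) (hX : REM.IsDisorder P X)
    (β : ℝ) (hβ : 0 < β) (t : ℕ → ℝ) (ht : Tendsto t atTop atTop) :
    (β < √(Real.log 2 / 2) →
      (t =o[atTop] (fun N : ℕ => √(N : ℝ)) →
        IsGoodRate (fun x : ℝ => ENNReal.ofReal (x ^ 2 / 2)) ∧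
        SatisfiesLDP P (REM.rescaledFreeEnergy P X β t) (fun N => t N ^ 2)
          (fun x : ℝ => ENNReal.ofReal (x ^ 2 / 2))) ∧
      (0 < liminf (fun N : ℕ => ((t N / √(N : ℝ) : ℝ) : EReal)) atTop →
        IsGoodRate REM.degenerateRate ∧
        ∀ γ : ℕ → ℝ, Tendsto γ atTop atTop → γ =o[atTop] (fun N : ℕ => (N : ℝ)) →
          SatisfiesLDP P (REM.rescaledFreeEnergy P X β t) γ REM.degenerateRate)) ∧
    (β = √(Real.log 2 / 2) →
      t =o[atTop] (fun N : ℕ => √(Real.log (N : ℝ))) →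
        IsGoodRate (fun x : ℝ => ENNReal.ofReal (x ^ 2)) ∧
        SatisfiesLDP P (REM.rescaledFreeEnergy P X β t) (fun N => t N ^ 2)
          (fun x : ℝ => ENNReal.ofReal (x ^ 2))) := by
  refine ⟨fun hβ2 => ⟨fun hto => ⟨?_, hX.satisfiesLDP_of_lt hβ hβ2 ht hto⟩, fun hlim =>
    ⟨isGoodRate_degenerateRate, fun γ hγ hγo =>
      hX.satisfiesLDP_degenerateRate hβ hβ2 hlim hγ hγo⟩⟩,
    fun hβ2 hto => ⟨?_, hX.satisfiesLDP_of_eq hβ hβ2 ht hto⟩⟩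
  · simpa using isGoodRate_sq_div one_pos
  · simpa using isGoodRate_sq_div (show (0 : ℝ) < 1 / 2 by norm_num)
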